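/- Let $\mathbb{K}$ be a field of characteristic $0$ and let $1\le\lambda\le n$ be integers. Let $T_n=\mathrm{End}(\{1,\dots,n\})$ be the transformation monoid (product = composition), let $pT_n\subset T_n$ be the planar transformation monoid, i.e. the submonoid of order-preserving maps, and let $S_\lambda$ be the symmetric group. For a finite monoid $S$ write $a\le_{lr} b$ if $b=cad$ for some $c,d\in S$; the classes of the associated equivalence relation are the $J$-cells. In $T_n$ and in $pT_n$ the $J$-cells are the sets $\mathcal{J}_\lambda$ of maps with exactly $\lambda$ elements in the image. A $\mathbb{K}S$-module has apex $\mathcal{J}$ if the $J$-cell $\mathcal{J}$ does not annihilate it and every strictly larger $J$-cell does; it has apex $\lambda$ if it has apex $\mathcal{J}_\lambda$. Let $\Delta_\lambda$ be the $\mathbb{K}T_n$-$\mathbb{K}S_\lambda$-bimodule with basis the injections $f\colon\{1,\dots,\lambda\}\to\{1,\dots,n\}$, where $a\in T_n$ sends $f$ to $a\circ f$ if this is injective and to $0$ otherwise, and $\sigma\in S_\lambda$ sends $f$ to $f\circ\sigma$. For a simple $\mathbb{K}S_\lambda$-module $K$ let $L_{\lambda,K}$ be the head (the quotient by the intersection of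 all maximal submodules) of $\Delta_\lambda\otimes_{\mathbb{K}S_\lambda}K$. (a) For every simple $\mathbb{K}S_\lambda$-module $K$, the $\mathbb{K}T_n$-module $L_{\lambda,K}$ is simple with apex $\lambda$, and $K$ and $L_{\lambda,K}$ are finite dimensional; every simple $\mathbb{K}T_n$-module with apex $\lambda$ is isomorphic to $L_{\lambda,K}$ for some simple $\mathbb{K}S_\lambda$-module $K$. If $K$ is not isomorphic to the sign module, then $$\dim L_{\lambda,K}=\binom{n}{\lambda}\cdot\dim K .$$ If $K$ is isomorphic to the sign module (which for $\lambda=1$ is the trivial module), then $$\dim L_{\lambda,K}=\binom{n-1}{\lambda-1},$$ and $L_{\lambda,K}\cong\bigwedge^{\lambda-1}M$, where $M=\{x\in\mathbb{K}^n\mid x_1+\dots+x_n=0\}$ is the reflection representation, with $a\in T_n$ acting on $\mathbb{K}^n$ by $e_i\mapsto e_{a(i)}$. (b) There is, up to isomorphism, exactly one simple $\mathbb{K}\,pT_n$-module $L_\lambda$ with apex $\lambda$, and $\dim L_\lambda=\binom{n-1}{\lambda-1}$. -/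

import Mathlib

/-!
Representations of the full transformation monoid and of its planar submonoid.  A (left) module
over the monoid algebra of a monoid `S` over a field `K` is treated as a representation
`ρ : Representation K S V`; simple modules are the irreducible representations.
-/

universe u v

noncomputable section

namespace TransMonoid

section Monoids

/-- The transformation monoid `T_n = End {1, …, n}`, with `a * b = a ∘ b`. -/
abbrev TMon (n : ℕ) : Type := Function.End (Fin n)

/-- The planar transformation monoid: a map can be drawn without crossing strings exactly if it is
order preserving. -/
def PTMon (n : ℕ) : Submonoid (TMon n) where
  carrier := {a | ∀ i j : Fin n, i ≤ j → a i ≤ a j}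
  one_mem' := fun _ _ h => h
  mul_mem' := fun {_ _} ha hb i j h => ha _ _ (hb i j h)

/-- The number of through strands of a diagram: the number of top points in the image. -/
def throughStrands {n : ℕ} (a : TMon n) : ℕ := (Set.range a).ncard

end Monoids

section Cells

variable {S : Type*} [Monoid S]

/-- The two-sided cell order `a ≤ b`: there are `c`, `d` with `b = c a d`. -/
def JLE (a b : S) : Prop := ∃ c d : S, b = c * a * d

/-- The two-sided cell (`J`-cell) of `a`. -/
def jCell (a : S) : Set S := {b | JLE a b ∧ JLE b a}

/-- `J` is an apex of `ρ`: it is a `J`-cell that does not annihilate the module, and every strictly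
larger `J`-cell annihilates the module. -/
def IsApex {K V : Type*} [Field K] [AddCommGroup V] [Module K V] (ρ : Representation K S V)
    (J : Set S) : Prop :=
  (∃ a, J = jCell a) ∧ (∃ a ∈ J, ρ a ≠ 0) ∧
    ∀ a ∈ J, ∀ b, JLE a b → ¬ JLE b a → ρ b = 0

end Cells

/-- `J_l` in `T_n`: the diagrams with `l` through strands. -/
def tCell (n l : ℕ) : Set (TMon n) := {a | throughStrands a = l}

/-- `J_l` in the planar transformation monoid: the planar diagrams with `l` through strands. -/
def ptCell (n l : ℕ) : Set (PTMon n) := {a | throughStrands (a : TMon n) = l}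

section Head

variable {S K V : Type*} [Monoid S] [Field K] [AddCommGroup V] [Module K V]

/-- The radical of a representation: the intersection of all maximal subrepresentations. -/
def radical (ρ : Representation K S V) : Subrepresentation ρ where
  toSubmodule := ⨅ N : {N : Subrepresentation ρ // IsCoatom N}, N.1.toSubmodule
  apply_mem_toSubmodule := fun g v hv => by
    rw [Submodule.mem_iInf] at hv ⊢
    exact fun N => N.1.apply_mem_toSubmodule g (hv N)

/-- The head of a representation: its quotient by the radical. -/
def head (ρ : Representation K S V) : Representation K S (V ⧸ (radical ρ).toSubmodule) :=
  ρ.quotient (radical ρ).toSubmodule fun g _ hv => (radical ρ).apply_mem_toSubmodule g hv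

end Head

section Induction

variable {K V : Type*} [Field K] [AddCommGroup V] [Module K V]

/-- The left action of `T_n` on `Δ_l ⊗ V`.  Here `Δ_l` is the left cell module of the `J`-cell of
maps with `l` through strands: after fixing the bottom of the diagrams, it has as basis the
injections `f : Fin l ↪ Fin n`, and `a` sends `f` to `a ∘ f` if this still has `l` through strands
(that is, if it is injective) and to `0` otherwise.  We identify `Δ_l ⊗ V` with the finitely
supported functions from the injections to `V`, with `f ⊗ v` being `Finsupp.single f v`. -/
def cellAction (K V : Type*) [Field K] [AddCommGroup V] [Module K V] {n : ℕ} (l : ℕ) (a : TMon n) :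
    ((Fin l ↪ Fin n) →₀ V) →ₗ[K] ((Fin l ↪ Fin n) →₀ V) :=
  open Classical in
  Finsupp.lsum ℕ fun f : Fin l ↪ Fin n =>
    if h : Function.Injective (a ∘ f) then Finsupp.lsingle ⟨a ∘ f, h⟩ else 0

theorem cellAction_single {n l : ℕ} (a : TMon n) (f : Fin l ↪ Fin n) (v : V)
    (h : Function.Injective (a ∘ f)) :
    cellAction K V l a (Finsupp.single f v) = Finsupp.single ⟨a ∘ f, h⟩ v := by
  simp [cellAction, h]

theorem cellAction_single_of_not {n l : ℕ} (a : TMon n) (f : Fin l ↪ Fin n) (v : V)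
    (h : ¬ Function.Injective (a ∘ f)) :
    cellAction K V l a (Finsupp.single f v) = 0 := by
  simp [cellAction, h]

/-- `Δ_l ⊗ V` as a representation of `T_n`. -/
def cellRep (K V : Type*) [Field K] [AddCommGroup V] [Module K V] (n l : ℕ) :
    Representation K (TMon n) ((Fin l ↪ Fin n) →₀ V) where
  toFun := cellAction K V l
  map_one' := by
    refine Finsupp.lhom_ext fun f v => ?_
    rw [cellAction_single _ _ _ (show Function.Injective ((1 : TMon n) ∘ f) from f.injective)]
    rfl
  map_mul' a b := by
    refine Finsupp.lhom_ext fun f v => ?_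
    rw [Module.End.mul_apply]
    by_cases hb : Function.Injective (b ∘ f)
    · rw [cellAction_single b f v hb]
      by_cases ha : Function.Injective (a ∘ b ∘ f)
      · rw [cellAction_single a ⟨b ∘ f, hb⟩ v ha,
          cellAction_single (a * b) f v (show Function.Injective ((a * b) ∘ f) from ha)]
        rfl
      · rw [cellAction_single_of_not a ⟨b ∘ f, hb⟩ v ha, cellAction_single_of_not (a * b) f v ha]
    · rw [cellAction_single_of_not b f v hb, map_zero]
      exact cellAction_single_of_not (a * b) f v
        fun h => hb (Function.Injective.of_comp (f := a) h)

/-- The relations `(f ∘ σ) ⊗ v = f ⊗ σ v` that turn `Δ_l ⊗ V` into the tensor product of `Δ_l` and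
`V` over the group algebra of the symmetric group `S_l`. -/
def balanced (n : ℕ) {l : ℕ} (ρ : Representation K (Equiv.Perm (Fin l)) V) :
    Submodule K ((Fin l ↪ Fin n) →₀ V) :=
  Submodule.span K {x | ∃ (f : Fin l ↪ Fin n) (σ : Equiv.Perm (Fin l)) (v : V),
    x = Finsupp.single (σ.toEmbedding.trans f) v - Finsupp.single f (ρ σ v)}

theorem balanced_le_comap (n : ℕ) {l : ℕ} (ρ : Representation K (Equiv.Perm (Fin l)) V)
    (a : TMon n) : balanced n ρ ≤ (balanced n ρ).comap (cellRep K V n l a) := by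
  refine Submodule.span_le.2 ?_
  rintro _ ⟨f, σ, v, rfl⟩
  change cellAction K V l a _ ∈ balanced n ρ
  rw [map_sub]
  by_cases h : Function.Injective (a ∘ f)
  · have h' : Function.Injective (a ∘ (σ.toEmbedding.trans f)) := h.comp σ.injective
    rw [cellAction_single _ _ _ h', cellAction_single _ _ _ h]
    exact Submodule.subset_span ⟨⟨a ∘ f, h⟩, σ, v, rfl⟩
  · have h' : ¬ Function.Injective (a ∘ (σ.toEmbedding.trans f)) := fun h' => h (by
      have := h'.comp σ.symm.injective
      convert this using 1
      funext i
      exact congrArg (fun j => a (f j)) (σ.apply_symm_apply i).symm)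
    rw [cellAction_single_of_not _ _ _ h', cellAction_single_of_not _ _ _ h, sub_zero]
    exact Submodule.zero_mem _

/-- The induction of a representation `V` of `S_l` to `T_n` along the cell with `l` through
strands, that is, the tensor product of `Δ_l` and `V` over the group algebra of `S_l`. -/
def inducedRep (n : ℕ) {l : ℕ} (ρ : Representation K (Equiv.Perm (Fin l)) V) :
    Representation K (TMon n) (((Fin l ↪ Fin n) →₀ V) ⧸ balanced n ρ) :=
  (cellRep K V n l).quotient (balanced n ρ) (balanced_le_comap n ρ)

/-- The underlying vector space of `simpleRep n ρ`. -/
abbrev SimpleSpace (n : ℕ) {l : ℕ} (ρ : Representation K (Equiv.Perm (Fin l)) V) :=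
  (((Fin l ↪ Fin n) →₀ V) ⧸ balanced n ρ) ⧸ (radical (inducedRep n ρ)).toSubmodule

/-- The representation of `T_n` that `H`-reduction associates to `l` and a simple
representation of `S_l`: the head of the induction. -/
def simpleRep (n : ℕ) {l : ℕ} (ρ : Representation K (Equiv.Perm (Fin l)) V) :
    Representation K (TMon n) (SimpleSpace n ρ) :=
  head (inducedRep n ρ)

end Induction

section Examples

variable (K : Type*) [Field K]

/-- The sign representation of the symmetric group `S_l`. -/
def signRep (l : ℕ) : Representation K (Equiv.Perm (Fin l)) K where
  toFun σ := ((Equiv.Perm.sign σ : ℤ) : K) • LinearMap.id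
  map_one' := by ext; simp
  map_mul' σ τ := by ext; simp [mul_comm]

/-- The natural representation of `T_n` on `K^n`: `a` sends the basis vector `e_i` to `e_(a i)`. -/
def naturalRep (n : ℕ) : Representation K (TMon n) (Fin n →₀ K) where
  toFun a := Finsupp.lmapDomain K K a
  map_one' := Finsupp.lmapDomain_id K K
  map_mul' a b := Finsupp.lmapDomain_comp K K b a

/-- The sum of the coordinates of a vector of `K^n`. -/
def coordSum (n : ℕ) : (Fin n →₀ K) →ₗ[K] K := Finsupp.lsum ℕ fun _ : Fin n => LinearMap.id

theorem coordSum_naturalRep {n : ℕ} (a : TMon n) (x : Fin n →₀ K) :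
    coordSum K n (naturalRep K n a x) = coordSum K n x := by
  refine LinearMap.congr_fun
    (f := coordSum K n ∘ₗ naturalRep K n a) (g := coordSum K n) (Finsupp.lhom_ext fun i c => ?_) x
  have h : naturalRep K n a (Finsupp.single i c) = Finsupp.single (a i) c :=
    Finsupp.mapDomain_single
  rw [LinearMap.comp_apply, h]
  simp [coordSum]

/-- The vectors of `K^n` with coordinate sum zero. -/
abbrev SumZero (n : ℕ) : Submodule K (Fin n →₀ K) := LinearMap.ker (coordSum K n)

/-- The reflection representation of `T_n`: the vectors of `K^n` with coordinate sum zero. -/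
def reflectionRep (n : ℕ) : Representation K (TMon n) (SumZero K n) where
  toFun a := (naturalRep K n a).restrict fun x hx => by
    rw [LinearMap.mem_ker] at hx ⊢
    rw [coordSum_naturalRep, hx]
  map_one' := by ext; simp
  map_mul' a b := by ext; simp

variable {K}

/-- The `k`-th exterior power of a representation. -/
def exteriorPowerRep {S V : Type*} [Monoid S] [AddCommGroup V] [Module K V] (k : ℕ)
    (ρ : Representation K S V) : Representation K S (⋀[K]^k V) where
  toFun g := exteriorPower.map k (ρ g)
  map_one' := by rw [map_one]; exact exteriorPower.map_id
  map_mul' g h := by rw [map_mul]; exact exteriorPower.map_comp (ρ h) (ρ g)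

/-- The `k`-th exterior power of the reflection representation of `T_n`. -/
def exteriorReflectionRep (K : Type*) [Field K] (n k : ℕ) :
    Representation K (TMon n) (⋀[K]^k (SumZero K n)) :=
  exteriorPowerRep k (reflectionRep K n)

end Examples

end TransMonoid

end

/-! Fix an increasing `i : Fin l → Fin n` with a monotone retraction `r`; the idempotent `i ∘ r`
represents the cell. Pairing the induced module with a total map `g : Fin n → Fin l` sends `f ⊗ v`
to `(g ∘ f) v`, or to `0` if `g ∘ f` is not a permutation. The common kernel `nullSub` of these
pairings is the largest proper submodule (`eq_top_of_not_le_nullSub`), hence the radical, and the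
head is simple. Conversely, a simple module with apex `l` is the head induced from the image of the
idempotent (`simpleRep_cornerRep_equiv`).

For the dimension, also allow partial maps `g`; pairing with the partial inverses of increasing
injections gives coordinates on the induced module. Filling the undefined points of `g` with the
value `i` gives a total map whose pairing is the sum of two partial ones (`eval_getD`): `g` itself,
and `g` with "undefined" and `i` exchanged. On `nullSub` such an exchange therefore negates the
pairing. A transposition of two values is a product of three exchanges, so it negates every
coordinate of a null vector (`swap_eval`). Thus `nullSub` vanishes unless the module of the
symmetric group is the sign module.

In the sign case, `f ⊗ 1 ↦ ⋀ (e_(f k) - e_(f 0))` maps the induced module onto the exterior power.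
That power is already simple over the planar monoid (`planarExterior_irreducible`): monotone maps
extract single coefficients in the basis of wedges of consecutive differences. Planar uniqueness
follows because a monotone permutation is the identity, so the apex alone determines how all `e a e`
act (`planar_character`, `equiv_of_character`). -/

noncomputable section

namespace TransMonoid

/-! ### Generalities on irreducible representations of monoids -/

section Generic

variable {S K V W : Type*} [Monoid S] [Field K] [AddCommGroup V] [Module K V]
  [AddCommGroup W] [Module K W]

/-- The subrepresentation generated by a vector. -/
def orbitSpan (ρ : Representation K S V) (v : V) : Subrepresentation ρ where
  toSubmodule := Submodule.span K (Set.range fun s => ρ s v)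
  apply_mem_toSubmodule := fun g w hw => by
    induction hw using Submodule.span_induction with
    | mem x hx =>
      obtain ⟨s, rfl⟩ := hx
      refine Submodule.subset_span ⟨g * s, ?_⟩
      simp
    | zero => simp
    | add x y _ _ hx hy => rw [map_add]; exact add_mem hx hy
    | smul c x _ hx => rw [map_smul]; exact Submodule.smul_mem _ _ hx

theorem mem_orbitSpan_self (ρ : Representation K S V) (v : V) :
    v ∈ (orbitSpan ρ v).toSubmodule :=
  Submodule.subset_span ⟨1, by simp⟩

theorem span_orbit_eq_top {ρ : Representation K S V} (hρ : ρ.IsIrreducible) {v : V} (hv : v ≠ 0) :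
    Submodule.span K (Set.range fun s => ρ s v) = ⊤ := by
  have := hρ
  rcases eq_bot_or_eq_top (orbitSpan ρ v) with h | h
  · refine absurd ?_ hv
    have h1 := mem_orbitSpan_self ρ v
    rw [h] at h1
    exact (Submodule.mem_bot K).1 h1
  · exact congrArg Subrepresentation.toSubmodule h

theorem irreducible_of_span_orbit {ρ : Representation K S V} [Nontrivial V]
    (h : ∀ v : V, v ≠ 0 → Submodule.span K (Set.range fun s => ρ s v) = ⊤) :
    ρ.IsIrreducible where
  exists_pair_ne := ⟨⊥, ⊤, fun h => by
    have h1 := congrArg Subrepresentation.toSubmodule h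
    exact bot_ne_top (α := Submodule K V) h1⟩
  eq_bot_or_eq_top U := by
    by_cases hU : U.toSubmodule = ⊥
    · exact Or.inl (Subrepresentation.toSubmodule_injective hU)
    · obtain ⟨v, hv, hv0⟩ := Submodule.exists_mem_ne_zero_of_ne_bot hU
      refine Or.inr (Subrepresentation.toSubmodule_injective (top_unique ?_))
      change ⊤ ≤ U.toSubmodule
      rw [← h v hv0, Submodule.span_le]
      rintro _ ⟨s, rfl⟩
      exact U.apply_mem_toSubmodule s hv

theorem nontrivial_of_irreducible {ρ : Representation K S V} (hρ : ρ.IsIrreducible) :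
    Nontrivial V := by
  by_contra h
  rw [not_nontrivial_iff_subsingleton] at h
  have := hρ
  exact bot_ne_top (α := Subrepresentation ρ)
    (Subrepresentation.toSubmodule_injective (Subsingleton.elim _ _))

/-- Nonzero orbits under the image of `θ` already span. -/
theorem irreducible_of_comp {T : Type*} [Monoid T] (θ : T →* S) (ρ : Representation K S V)
    (h : Representation.IsIrreducible (MonoidHom.comp ρ θ : Representation K T V)) :
    ρ.IsIrreducible := by
  have := nontrivial_of_irreducible h
  refine irreducible_of_span_orbit fun v hv => top_unique ?_
  rw [← span_orbit_eq_top h hv]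
  refine Submodule.span_mono ?_
  rintro _ ⟨t, rfl⟩
  exact ⟨θ t, rfl⟩

/-- A nonzero intertwining map to an irreducible representation is surjective. -/
theorem surjective_of_ne_zero {ρ : Representation K S V} {σ : Representation K S W}
    (hσ : σ.IsIrreducible) (φ : ρ.IntertwiningMap σ) {x : V} (hx : φ x ≠ 0) :
    Function.Surjective φ := by
  have := hσ
  refine (Representation.IsIrreducible.surjective_or_eq_zero φ).resolve_right fun h => hx ?_
  rw [h]; rfl

/-! ### Representations with a greatest proper subrepresentation, and their heads -/

section Local

variable {ρ : Representation K S V} {N : Subrepresentation ρ}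

/-- The hypotheses make `N` the greatest proper subrepresentation, hence the only coatom. -/
theorem radical_eq (hN : N ≠ ⊤) (h : ∀ U : Subrepresentation ρ, ¬ U ≤ N → U = ⊤) :
    radical ρ = N := by
  have hc : IsCoatom N := ⟨hN, fun U hU => h U (not_le_of_gt hU)⟩
  have hu : ∀ U : Subrepresentation ρ, IsCoatom U → U = N := fun U hU => by
    by_contra hne
    have : U ≤ N := by
      by_contra h'
      exact hU.1 (h U h')
    exact hN (hU.2 N (lt_of_le_of_ne this hne))
  refine Subrepresentation.toSubmodule_injective (le_antisymm ?_ ?_)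
  · exact iInf_le (fun N : {N : Subrepresentation ρ // IsCoatom N} => N.1.toSubmodule) ⟨N, hc⟩
  · refine le_iInf fun U => ?_
    rw [hu U.1 U.2]

theorem head_apply_mk (s : S) (x : V) :
    head ρ s (Submodule.Quotient.mk x) = Submodule.Quotient.mk (ρ s x) := rfl

theorem head_irreducible (hN : N ≠ ⊤) (h : ∀ U : Subrepresentation ρ, ¬ U ≤ N → U = ⊤) :
    (head ρ).IsIrreducible := by
  have hr := radical_eq hN h
  have : Nontrivial (V ⧸ (radical ρ).toSubmodule) := by
    rw [Submodule.Quotient.nontrivial_iff, hr]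
    exact fun h' => hN (Subrepresentation.toSubmodule_injective h')
  refine irreducible_of_span_orbit fun v hv => ?_
  obtain ⟨x, rfl⟩ := Submodule.Quotient.mk_surjective _ v
  have hx : ¬ orbitSpan ρ x ≤ N := fun hle => hv <| by
    rw [Submodule.Quotient.mk_eq_zero, hr]
    exact hle (mem_orbitSpan_self ρ x)
  have ht : Submodule.span K (Set.range fun s => ρ s x) = ⊤ :=
    congrArg Subrepresentation.toSubmodule (h _ hx)
  have h2 := congrArg (Submodule.map (radical ρ).toSubmodule.mkQ) ht
  rw [Submodule.map_span, Submodule.map_top, Submodule.range_mkQ, ← Set.range_comp] at h2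
  exact h2

/-- The kernel of `φ` is proper, so it lies in `N`. If `N` were not in the kernel, its image would
be all of the irreducible target, so `N` plus the kernel, which is `N`, would be everything. Hence
`φ` factors through the head. -/
theorem head_equiv_of_surjective (hN : N ≠ ⊤)
    (h : ∀ U : Subrepresentation ρ, ¬ U ≤ N → U = ⊤) {σ : Representation K S W}
    (hσ : σ.IsIrreducible) (φ : ρ.IntertwiningMap σ) (hφ : Function.Surjective φ) :
    Nonempty ((head ρ).Equiv σ) := by
  have hr := radical_eq hN h
  have := nontrivial_of_irreducible hσ
  have hker : φ.ker ≤ N := by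
    by_contra hle
    obtain ⟨w, hw⟩ := exists_ne (0 : W)
    obtain ⟨x, rfl⟩ := hφ w
    have : x ∈ φ.ker := by rw [h _ hle]; exact Submodule.mem_top (R := K)
    exact hw this
  have hle : (radical ρ).toSubmodule ≤ LinearMap.ker φ.toLinearMap := by
    rw [hr]
    intro x hx
    by_contra hx0
    have ht : Submodule.map φ.toLinearMap N.toSubmodule = ⊤ := by
      refine top_unique ?_
      rw [← span_orbit_eq_top hσ (v := φ x) hx0, Submodule.span_le]
      rintro _ ⟨s, rfl⟩
      exact ⟨ρ s x, N.apply_mem_toSubmodule s hx, φ.isIntertwining _ _ s x⟩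
    refine hN (Subrepresentation.toSubmodule_injective (top_unique fun y _ => ?_))
    obtain ⟨z, hz, hzy⟩ : φ y ∈ Submodule.map φ.toLinearMap N.toSubmodule := by
      rw [ht]; trivial
    have h1 : y - z ∈ φ.ker := by
      change φ.toLinearMap (y - z) = 0
      rw [map_sub, hzy]
      exact sub_self _
    have h2 := N.toSubmodule.add_mem (hker h1) hz
    rwa [sub_add_cancel] at h2
  let ψ : (head ρ).IntertwiningMap σ :=
    ⟨(radical ρ).toSubmodule.liftQ φ.toLinearMap hle, fun s => by
      ext x
      exact φ.isIntertwining _ _ s x⟩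
  have hirr := head_irreducible hN h
  refine ⟨ψ.ofBijective ⟨?_, fun w => ?_⟩⟩
  · refine (Representation.IsIrreducible.injective_or_eq_zero ψ).resolve_right fun h0 => ?_
    obtain ⟨w, hw⟩ := exists_ne (0 : W)
    obtain ⟨x, rfl⟩ := hφ w
    have h1 : ψ (Submodule.Quotient.mk x) = φ x := rfl
    rw [h0] at h1
    exact hw h1.symm
  · obtain ⟨x, rfl⟩ := hφ w
    exact ⟨Submodule.Quotient.mk x, rfl⟩

end Local

/-! ### Irreducible representations determined by the action of the elements `e s e` -/

section Character

/-- Otherwise `e` kills the span of the orbit of `x`, which is everything, although it fixes `w`. -/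
theorem exists_apply_ne_zero {π : Representation K S V} (hπ : π.IsIrreducible) {e : S} {w : V}
    (hw : w ≠ 0) (he : π e w = w) {x : V} (hx : x ≠ 0) : ∃ t, π (e * t) x ≠ 0 := by
  by_contra! h
  have h1 : Submodule.span K (Set.range fun s => π s x) ≤ LinearMap.ker (π e) := by
    rw [Submodule.span_le]
    rintro _ ⟨s, rfl⟩
    have h2 := h s
    rwa [map_mul] at h2
  rw [span_orbit_eq_top hπ hx] at h1
  exact hw (he.symm.trans (h1 (Submodule.mem_top (x := w))))

/-- A vector vanishes as soon as all `e t` kill it, and `e t s w = e (t s) e w = χ (t s) w`. So the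
linear relations in the orbit of `w` depend on `χ` only. -/
theorem ker_linearCombination_orbit {π : Representation K S V} (hπ : π.IsIrreducible) {e : S}
    {χ : S → K} (hχ : ∀ s, π (e * s * e) = χ s • π e) {w : V} (hw : w ≠ 0) (he : π e w = w)
    (c : S →₀ K) :
    Finsupp.linearCombination K (fun s => π s w) c = 0 ↔
      ∀ t, (c.sum fun s a => a * χ (t * s)) = 0 := by
  have key : ∀ t, π (e * t) (Finsupp.linearCombination K (fun s => π s w) c) =
      (c.sum fun s a => a * χ (t * s)) • w := fun t => by
    rw [Finsupp.linearCombination_apply, Finsupp.sum, Finsupp.sum, map_sum, Finset.sum_smul]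
    refine Finset.sum_congr rfl fun s _ => ?_
    have h1 : π (e * t) (π s w) = χ (t * s) • w := by
      conv_lhs => rw [← he]
      rw [← Module.End.mul_apply, ← Module.End.mul_apply, ← map_mul, ← map_mul,
        mul_assoc e t s, hχ, LinearMap.smul_apply, he]
    rw [map_smul, h1, smul_smul]
  constructor
  · intro h t
    have h1 := key t
    rw [h, map_zero] at h1
    exact (smul_eq_zero.1 h1.symm).resolve_right hw
  · intro h
    by_contra hx
    obtain ⟨t, ht⟩ := exists_apply_ne_zero hπ hw he hx
    rw [key, h, zero_smul] at ht
    exact ht rfl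

theorem linearCombination_orbit_surjective {π : Representation K S V} (hπ : π.IsIrreducible)
    {w : V} (hw : w ≠ 0) : Function.Surjective (Finsupp.linearCombination K fun s => π s w) := by
  rw [← LinearMap.range_eq_top, Finsupp.range_linearCombination]
  exact span_orbit_eq_top hπ hw

theorem linearCombination_orbit_mapDomain (π : Representation K S V) (w : V) (t : S)
    (c : S →₀ K) :
    Finsupp.linearCombination K (fun s => π s w) (c.mapDomain (t * ·)) =
      π t (Finsupp.linearCombination K (fun s => π s w) c) := by
  rw [Finsupp.linearCombination_mapDomain, Finsupp.linearCombination_apply,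
    Finsupp.linearCombination_apply, Finsupp.sum, Finsupp.sum, map_sum]
  refine Finset.sum_congr rfl fun s _ => ?_
  simp

/-- Two irreducible representations on which an idempotent `e` acts nontrivially are isomorphic if
the elements `e s e` act on them by the same multiples of `e`. -/
theorem equiv_of_character {π : Representation K S V} {π' : Representation K S W}
    (hπ : π.IsIrreducible) (hπ' : π'.IsIrreducible) {e : S} (he : e * e = e) {χ : S → K}
    (hχ : ∀ s, π (e * s * e) = χ s • π e) (hχ' : ∀ s, π' (e * s * e) = χ s • π' e)
    (h : π e ≠ 0) (h' : π' e ≠ 0) : Nonempty (π.Equiv π') := by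
  obtain ⟨w₀, hw₀⟩ : ∃ w, π e w ≠ 0 := by
    by_contra! h0
    exact h (LinearMap.ext h0)
  obtain ⟨w₁, hw₁⟩ : ∃ w, π' e w ≠ 0 := by
    by_contra! h0
    exact h' (LinearMap.ext h0)
  have e₀ : π e (π e w₀) = π e w₀ := by rw [← Module.End.mul_apply, ← map_mul, he]
  have e₁ : π' e (π' e w₁) = π' e w₁ := by rw [← Module.End.mul_apply, ← map_mul, he]
  let f := Finsupp.linearCombination K fun s => π s (π e w₀)
  let f' := Finsupp.linearCombination K fun s => π' s (π' e w₁)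
  -- Both modules are quotients of the free module on `S`, by relations that `χ` determines.
  have hker : LinearMap.ker f = LinearMap.ker f' := by
    ext c
    exact (ker_linearCombination_orbit hπ hχ hw₀ e₀ c).trans
      (ker_linearCombination_orbit hπ' hχ' hw₁ e₁ c).symm
  have hf : Function.Surjective f := linearCombination_orbit_surjective hπ hw₀
  have hf' : Function.Surjective f' := linearCombination_orbit_surjective hπ' hw₁
  let E : V ≃ₗ[K] W := (f.quotKerEquivOfSurjective hf).symm ≪≫ₗ
    Submodule.quotEquivOfEq _ _ hker ≪≫ₗ f'.quotKerEquivOfSurjective hf'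
  have hE : ∀ c, E (f c) = f' c := fun c => by
    have h1 : (f.quotKerEquivOfSurjective hf).symm (f c) = Submodule.Quotient.mk c := by
      rw [LinearEquiv.symm_apply_eq]; rfl
    change f'.quotKerEquivOfSurjective hf' (Submodule.quotEquivOfEq _ _ hker
      ((f.quotKerEquivOfSurjective hf).symm (f c))) = _
    rw [h1]; rfl
  refine ⟨Representation.Equiv.mk E fun t => LinearMap.ext fun x => ?_⟩
  obtain ⟨c, rfl⟩ := hf x
  change E (π t (f c)) = π' t (E (f c))
  rw [hE, ← linearCombination_orbit_mapDomain, ← linearCombination_orbit_mapDomain]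
  exact hE _

end Character

end Generic

/-! ### Through strands and factorization through `Fin l` -/

section Factor

variable {n l : ℕ}

theorem throughStrands_mul_le_left (a b : TMon n) : throughStrands (a * b) ≤ throughStrands a :=
  Set.ncard_le_ncard (Set.range_comp_subset_range b a) (Set.toFinite _)

theorem throughStrands_mul_le_right (a b : TMon n) : throughStrands (a * b) ≤ throughStrands b := by
  have h : Set.range (a * b) = a '' Set.range b := Set.range_comp _ _
  rw [throughStrands, h]
  exact Set.ncard_image_le (Set.toFinite _)

theorem throughStrands_le_of_JLE {a b : TMon n} (h : JLE a b) :
    throughStrands b ≤ throughStrands a := by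
  obtain ⟨c, d, rfl⟩ := h
  exact (throughStrands_mul_le_left _ _).trans (throughStrands_mul_le_right _ _)

theorem throughStrands_comp_lt {f : Fin l → Fin n} (hf : ¬ Function.Injective f)
    (g : Fin n → Fin l) : throughStrands (f ∘ g : TMon n) < l := by
  refine (Set.ncard_le_ncard (Set.range_comp_subset_range g f) (Set.toFinite _)).trans_lt ?_
  rw [← Set.image_univ]
  have h1 : (f '' Set.univ).ncard ≤ (Set.univ : Set (Fin l)).ncard :=
    Set.ncard_image_le (Set.toFinite _)
  have h2 : (Set.univ : Set (Fin l)).ncard = l := by simp [Set.ncard_univ]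
  refine lt_of_le_of_ne (h1.trans h2.le) fun h => hf ?_
  rw [← Set.injOn_univ]
  exact Set.injOn_of_ncard_image_eq (h.trans h2.symm) (Set.toFinite _)

theorem throughStrands_eq {f : Fin l → Fin n} (hf : Function.Injective f)
    {g : Fin n → Fin l} (hg : Function.Surjective g) : throughStrands (f ∘ g : TMon n) = l := by
  change (Set.range (f ∘ g)).ncard = l
  rw [hg.range_comp, ← Set.image_univ, Set.ncard_image_of_injective _ hf]
  simp [Set.ncard_univ]

theorem not_injective_comp {a : TMon n} (ha : throughStrands a < l) (f : Fin l → Fin n) :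
    ¬ Function.Injective (a ∘ f) := fun h => by
  have h1 : (Set.range (a ∘ f)).ncard = l := by
    rw [← Set.image_univ, Set.ncard_image_of_injective _ h]
    simp [Set.ncard_univ]
  have h2 : (Set.range (a ∘ f)).ncard ≤ (Set.range a).ncard :=
    Set.ncard_le_ncard (Set.range_comp_subset_range f a) (Set.toFinite _)
  exact absurd (h1 ▸ h2) (not_le.2 ha)

/-- A strictly monotone map has a monotone retraction. -/
theorem exists_monotone_leftInverse (hl : 1 ≤ l) {f : Fin l → Fin n} (hf : StrictMono f) :
    ∃ q : Fin n → Fin l, Monotone q ∧ ∀ i, q (f i) = i := by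
  have : NeZero l := ⟨by omega⟩
  -- The retraction takes the largest `j` with `f j ≤ x`; points below the image of `f` go to `0`,
  -- which exists because `1 ≤ l`.
  refine ⟨fun x => (Finset.univ.filter fun j => f j ≤ x).sup id, fun x y h => ?_, fun i => ?_⟩
  · refine Finset.sup_mono fun j => ?_
    simp only [Finset.mem_filter, Finset.mem_univ, true_and]
    exact fun h' => h'.trans h
  · refine le_antisymm (Finset.sup_le fun j hj => ?_) ?_
    · simpa [hf.le_iff_le] using hj
    · exact Finset.le_sup (f := id) (by simp)

theorem exists_retraction (hl : 1 ≤ l) (hln : l ≤ n) :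
    ∃ (i : Fin l → Fin n) (r : Fin n → Fin l), StrictMono i ∧ Monotone r ∧ ∀ k, r (i k) = k := by
  obtain ⟨q, hq, h⟩ := exists_monotone_leftInverse hl (Fin.strictMono_castLE hln)
  exact ⟨_, q, Fin.strictMono_castLE hln, hq, h⟩

/-- A map with `l` elements in its image factors through `Fin l`, with one-sided inverses of the two
factors that are monotone if the map is. -/
theorem exists_factorization (hl : 1 ≤ l) {a : Fin n → Fin n} (ha : (Set.range a).ncard = l) :
    ∃ (f : Fin l → Fin n) (g : Fin n → Fin l) (q : Fin n → Fin l) (s : Fin l → Fin n),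
      (∀ x, a x = f (g x)) ∧ (∀ k, q (f k) = k) ∧ (∀ k, g (s k) = k) ∧ StrictMono f ∧
      Monotone q ∧ (Monotone a → Monotone g ∧ Monotone s) := by
  classical
  have hc : (Finset.univ.image a).card = l := by
    rw [← ha, ← Set.ncard_coe_finset, Finset.coe_image, Finset.coe_univ, Set.image_univ]
  let o := (Finset.univ.image a).orderIsoOfFin hc
  let f : Fin l → Fin n := fun k => (o k : Fin n)
  have hf : StrictMono f := fun i j h => o.strictMono h
  obtain ⟨q, hq, hqf⟩ := exists_monotone_leftInverse hl hf
  have hs : ∀ k, ∃ x, a x = f k := fun k => by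
    obtain ⟨x, -, hx⟩ := Finset.mem_image.1 (o k).2
    exact ⟨x, hx⟩
  choose s hs using hs
  let g : Fin n → Fin l := fun x => o.symm ⟨a x, by simp⟩
  have hfg : ∀ x, a x = f (g x) := fun x => by simp [f, g]
  refine ⟨f, g, q, s, hfg, hqf, fun k => hf.injective ?_, hf, hq, fun hm => ⟨fun x y h => ?_, ?_⟩⟩
  · rw [← hfg, hs]
  · rw [← hf.le_iff_le, ← hfg, ← hfg]
    exact hm h
  -- Any choice of preimages of increasing values under a monotone map is increasing.
  · refine StrictMono.monotone fun i j h => ?_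
    by_contra! h'
    have h1 := hm h'
    rw [hs, hs, hf.le_iff_le] at h1
    exact absurd h (not_lt.2 h1)

/-- This is why no symmetric group survives in the planar monoid, and why increasing injections are
determined by their image. -/
theorem eq_id_of_monotone_injective {u : Fin l → Fin l} (hu : Monotone u)
    (hi : Function.Injective u) : u = id :=
  (StrictMono.range_inj (hu.strictMono_of_injective hi) strictMono_id).1 (by
    rw [(Finite.surjective_of_injective hi).range_eq, Set.range_id])

end Factor

/-! ### Cells and apexes in terms of through strands -/

section Apex

variable {n l : ℕ} {S K V : Type*} [Monoid S] [Field K] [AddCommGroup V] [Module K V]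

/-- The elements with `l` through strands form a single cell. -/
structure IsStrandCell (θ : S →* TMon n) (l : ℕ) (e : S) : Prop where
  strands : throughStrands (θ e) = l
  JLE_of_eq : ∀ b, throughStrands (θ b) = l → JLE e b ∧ JLE b e

theorem JLE_map (θ : S →* TMon n) {a b : S} (h : JLE a b) : JLE (θ a) (θ b) := by
  obtain ⟨c, d, rfl⟩ := h
  exact ⟨θ c, θ d, by simp⟩

theorem jCell_eq {θ : S →* TMon n} {e : S} (h : IsStrandCell θ l e) :
    {a | throughStrands (θ a) = l} = jCell e := by
  ext b
  refine ⟨h.JLE_of_eq b, fun hb => le_antisymm ?_ ?_⟩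
  · exact (throughStrands_le_of_JLE (JLE_map θ hb.1)).trans h.strands.le
  · exact h.strands.ge.trans (throughStrands_le_of_JLE (JLE_map θ hb.2))

/-- An element above the cell has at most `l` strands; with exactly `l` it would be back in the
cell. -/
theorem isApex_of {θ : S →* TMon n} {e : S} (h : IsStrandCell θ l e) {ρ : Representation K S V}
    (he : ρ e ≠ 0) (h0 : ∀ b, throughStrands (θ b) < l → ρ b = 0) :
    IsApex ρ {a | throughStrands (θ a) = l} := by
  refine ⟨⟨e, jCell_eq h⟩, ⟨e, h.strands, he⟩, fun a ha b hab hba => h0 b ?_⟩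
  have ha : throughStrands (θ a) = l := ha
  refine lt_of_le_of_ne ((throughStrands_le_of_JLE (JLE_map θ hab)).trans ha.le) fun hb => hba ?_
  obtain ⟨c, d, hcd⟩ := (h.JLE_of_eq b hb).2
  obtain ⟨c', d', hcd'⟩ := (h.JLE_of_eq a ha).1
  exact ⟨c' * c, d * d', by rw [hcd', hcd]; simp only [mul_assoc]⟩

theorem apply_ne_zero_of_isApex {θ : S →* TMon n} {e : S} (h : IsStrandCell θ l e)
    {ρ : Representation K S V} (hρ : IsApex ρ {a | throughStrands (θ a) = l}) : ρ e ≠ 0 := by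
  obtain ⟨-, ⟨a, ha, ha0⟩, -⟩ := hρ
  obtain ⟨c, d, rfl⟩ := (h.JLE_of_eq a ha).1
  intro he
  rw [map_mul, map_mul, he, mul_zero, zero_mul] at ha0
  exact ha0 rfl

theorem apply_eq_zero_of_isApex {θ : S →* TMon n} {e : S} (h : IsStrandCell θ l e)
    {ρ : Representation K S V} (hρ : IsApex ρ {a | throughStrands (θ a) = l}) {b : S}
    (hb : throughStrands (θ b) < l) (hJ : JLE e b) : ρ b = 0 := by
  refine hρ.2.2 e h.strands b hJ fun h' => ?_
  exact absurd (h.strands ▸ throughStrands_le_of_JLE (JLE_map θ h')) (not_le.2 hb)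

variable {i : Fin l → Fin n} {r : Fin n → Fin l}

/-- If `b = f ∘ g` with one-sided inverses `q`, `s`, then `b = (f r)(i r)(i g)` and `i r = (i q) b
(s r)`. The planar version uses the same formulas, all of whose factors are then monotone. -/
theorem isStrandCell_id (hl : 1 ≤ l) (hri : ∀ k, r (i k) = k) :
    IsStrandCell (MonoidHom.id (TMon n)) l (i ∘ r : TMon n) where
  strands := throughStrands_eq (Function.LeftInverse.injective hri)
    (Function.RightInverse.surjective hri)
  JLE_of_eq b hb := by
    obtain ⟨f, g, q, s, hfg, hqf, hgs, -⟩ := exists_factorization hl hb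
    have hb : b = f ∘ g := funext hfg
    subst hb
    refine ⟨⟨(f ∘ r : TMon n), (i ∘ g : TMon n), ?_⟩, ⟨(i ∘ q : TMon n), (s ∘ r : TMon n), ?_⟩⟩
    · funext x
      change f (g x) = f (r (i (r (i (g x)))))
      rw [hri, hri]
    · funext x
      change i (r x) = i (q (f (g (s (r x)))))
      rw [hgs, hqf]

/-- The element of the planar monoid given by a monotone map. -/
def planar {a : Fin n → Fin n} (ha : Monotone a) : PTMon n := ⟨a, fun _ _ h => ha h⟩

theorem isStrandCell_planar (hl : 1 ≤ l) (hi : Monotone i) (hr : Monotone r)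
    (hri : ∀ k, r (i k) = k) : IsStrandCell (PTMon n).subtype l (planar (hi.comp hr)) where
  strands := throughStrands_eq (Function.LeftInverse.injective hri)
    (Function.RightInverse.surjective hri)
  JLE_of_eq b hb := by
    obtain ⟨f, g, q, s, hfg, hqf, hgs, hf, hq, hm⟩ := exists_factorization hl hb
    obtain ⟨hg, hs⟩ := hm fun _ _ h => b.2 _ _ h
    refine ⟨⟨planar (hf.monotone.comp hr), planar (hi.comp hg), ?_⟩,
      ⟨planar (hi.comp hq), planar (hs.comp hr), ?_⟩⟩
    · refine Subtype.ext (funext fun x => ?_)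
      change b.1 x = f (r (i (r (i (g x)))))
      rw [hri, hri]
      exact hfg x
    · refine Subtype.ext (funext fun x => ?_)
      change i (r x) = i (q (b.1 (s (r x))))
      have h1 : b.1 (s (r x)) = f (r x) := (hfg _).trans (congrArg f (hgs _))
      rw [h1, hqf]

end Apex

/-! ### Pairing the induced representation with partial maps -/

section Evaluation

variable {n l : ℕ} {K V : Type*} [Field K] [AddCommGroup V] [Module K V]
  (ρ : Representation K (Equiv.Perm (Fin l)) V)

/-- Evaluation of `Δ_l ⊗ V` at a partial map `g`: the tensor `f ⊗ v` is sent to `(g ∘ f) v` if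
`g ∘ f` is a permutation, and to zero otherwise. -/
def cellEval (g : Fin n → Option (Fin l)) : ((Fin l ↪ Fin n) →₀ V) →ₗ[K] V :=
  open Classical in
  Finsupp.lsum ℕ fun f : Fin l ↪ Fin n =>
    if h : ∃ σ : Equiv.Perm (Fin l), ∀ k, g (f k) = some (σ k) then ρ h.choose else 0

variable {ρ}

theorem cellEval_single {g : Fin n → Option (Fin l)} {f : Fin l ↪ Fin n} {σ : Equiv.Perm (Fin l)}
    (h : ∀ k, g (f k) = some (σ k)) (v : V) : cellEval ρ g (Finsupp.single f v) = ρ σ v := by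
  have h' : ∃ σ : Equiv.Perm (Fin l), ∀ k, g (f k) = some (σ k) := ⟨σ, h⟩
  have h2 : h'.choose = σ := Equiv.ext fun k =>
    Option.some_injective _ ((h'.choose_spec k).symm.trans (h k))
  simp only [cellEval, Finsupp.lsum_single, dif_pos h']
  rw [h2]

theorem cellEval_single_of_not {g : Fin n → Option (Fin l)} {f : Fin l ↪ Fin n}
    (h : ¬ ∃ σ : Equiv.Perm (Fin l), ∀ k, g (f k) = some (σ k)) (v : V) :
    cellEval ρ g (Finsupp.single f v) = 0 := by
  simp only [cellEval, Finsupp.lsum_single, dif_neg h, LinearMap.zero_apply]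

theorem balanced_le_ker (g : Fin n → Option (Fin l)) :
    balanced n ρ ≤ LinearMap.ker (cellEval ρ g) := by
  refine Submodule.span_le.2 ?_
  rintro _ ⟨f, σ, v, rfl⟩
  change cellEval ρ g _ = 0
  rw [map_sub, sub_eq_zero]
  by_cases h : ∃ τ : Equiv.Perm (Fin l), ∀ k, g (f k) = some (τ k)
  · obtain ⟨τ, hτ⟩ := h
    rw [cellEval_single hτ, cellEval_single (σ := τ * σ) (fun k => hτ (σ k)), map_mul]
    rfl
  · rw [cellEval_single_of_not h, cellEval_single_of_not]
    rintro ⟨τ, hτ⟩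
    refine h ⟨τ * σ⁻¹, fun k => ?_⟩
    have := hτ (σ⁻¹ k)
    simpa using this

variable (ρ) in
/-- The evaluation at a partial map on the induced representation. -/
def eval (g : Fin n → Option (Fin l)) : (((Fin l ↪ Fin n) →₀ V) ⧸ balanced n ρ) →ₗ[K] V :=
  (balanced n ρ).liftQ (cellEval ρ g) (balanced_le_ker g)

variable (ρ) in
/-- The pure tensor `f ⊗ v` in the induced representation. -/
def tmk (f : Fin l ↪ Fin n) : V →ₗ[K] (((Fin l ↪ Fin n) →₀ V) ⧸ balanced n ρ) :=
  (balanced n ρ).mkQ ∘ₗ Finsupp.lsingle f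

theorem inducedRep_hom_ext {W : Type*} [AddCommGroup W] [Module K W]
    {φ ψ : (((Fin l ↪ Fin n) →₀ V) ⧸ balanced n ρ) →ₗ[K] W}
    (h : ∀ f v, φ (tmk ρ f v) = ψ (tmk ρ f v)) : φ = ψ := by
  refine Submodule.linearMap_qext _ (Finsupp.lhom_ext fun f v => h f v)

/-- A linear map on the induced representation is given by a balanced family of linear maps. -/
def inducedLift {W : Type*} [AddCommGroup W] [Module K W] (F : (Fin l ↪ Fin n) → V →ₗ[K] W)
    (h : ∀ f (σ : Equiv.Perm (Fin l)) v, F (σ.toEmbedding.trans f) v = F f (ρ σ v)) :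
    (((Fin l ↪ Fin n) →₀ V) ⧸ balanced n ρ) →ₗ[K] W :=
  (balanced n ρ).liftQ (Finsupp.lsum ℕ F) (by
    refine Submodule.span_le.2 ?_
    rintro _ ⟨f, σ, v, rfl⟩
    change Finsupp.lsum ℕ F _ = 0
    rw [map_sub, Finsupp.lsum_single, Finsupp.lsum_single, h, sub_self])

theorem inducedLift_tmk {W : Type*} [AddCommGroup W] [Module K W]
    (F : (Fin l ↪ Fin n) → V →ₗ[K] W)
    (h : ∀ f (σ : Equiv.Perm (Fin l)) v, F (σ.toEmbedding.trans f) v = F f (ρ σ v))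
    (f : Fin l ↪ Fin n) (v : V) : inducedLift F h (tmk ρ f v) = F f v :=
  Finsupp.lsum_single ℕ F f v

theorem tmk_trans (f : Fin l ↪ Fin n) (σ : Equiv.Perm (Fin l)) (v : V) :
    tmk ρ (σ.toEmbedding.trans f) v = tmk ρ f (ρ σ v) :=
  (Submodule.Quotient.eq _).2 (Submodule.subset_span ⟨f, σ, v, rfl⟩)

theorem inducedRep_tmk {a : TMon n} {f : Fin l ↪ Fin n} (h : Function.Injective (a ∘ f)) (v : V) :
    inducedRep n ρ a (tmk ρ f v) = tmk ρ ⟨a ∘ f, h⟩ v :=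
  congrArg (balanced n ρ).mkQ (cellAction_single a f v h)

theorem inducedRep_tmk_of_not {a : TMon n} {f : Fin l ↪ Fin n}
    (h : ¬ Function.Injective (a ∘ f)) (v : V) : inducedRep n ρ a (tmk ρ f v) = 0 :=
  (congrArg (balanced n ρ).mkQ (cellAction_single_of_not a f v h)).trans (map_zero _)

theorem eval_tmk {g : Fin n → Option (Fin l)} {f : Fin l ↪ Fin n} {σ : Equiv.Perm (Fin l)}
    (h : ∀ k, g (f k) = some (σ k)) (v : V) : eval ρ g (tmk ρ f v) = ρ σ v :=
  cellEval_single h v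

theorem eval_tmk_of_not {g : Fin n → Option (Fin l)} {f : Fin l ↪ Fin n}
    (h : ¬ ∃ σ : Equiv.Perm (Fin l), ∀ k, g (f k) = some (σ k)) (v : V) :
    eval ρ g (tmk ρ f v) = 0 :=
  cellEval_single_of_not h v

/-- The monoid acts on pairings by precomposition, which keeps total maps total; hence `nullSub` is
stable. -/
theorem eval_inducedRep (g : Fin n → Option (Fin l)) (a : TMon n)
    (x : ((Fin l ↪ Fin n) →₀ V) ⧸ balanced n ρ) :
    eval ρ g (inducedRep n ρ a x) = eval ρ (fun y => g (a y)) x := by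
  refine LinearMap.congr_fun (f := eval ρ g ∘ₗ inducedRep n ρ a)
    (inducedRep_hom_ext fun f v => ?_) x
  rw [LinearMap.comp_apply]
  by_cases ha : Function.Injective (a ∘ f)
  · rw [inducedRep_tmk ha]
    by_cases h : ∃ σ : Equiv.Perm (Fin l), ∀ k, g (a (f k)) = some (σ k)
    · obtain ⟨σ, hσ⟩ := h
      rw [eval_tmk (f := ⟨a ∘ f, ha⟩) hσ, eval_tmk hσ]
    · rw [eval_tmk_of_not (f := ⟨a ∘ f, ha⟩) h, eval_tmk_of_not h]
  · rw [inducedRep_tmk_of_not ha, map_zero, eval_tmk_of_not]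
    rintro ⟨σ, hσ⟩
    refine ha fun i j hij => σ.injective (Option.some_injective _ ?_)
    rw [← hσ, ← hσ]
    exact congrArg g hij

/-- Merging the points where `g` is undefined into the fiber over `i` gives the sum of `g` and of
the map obtained by exchanging those points with the fiber. -/
theorem eval_getD (g : Fin n → Option (Fin l)) (i : Fin l)
    (x : ((Fin l ↪ Fin n) →₀ V) ⧸ balanced n ρ) :
    eval ρ (fun y => some ((g y).getD i)) x =
      eval ρ g x + eval ρ (fun y => Equiv.swap none (some i) (g y)) x := by
  refine LinearMap.congr_fun (g := eval ρ g + eval ρ fun y => Equiv.swap none (some i) (g y))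
    (inducedRep_hom_ext fun f v => ?_) x
  rw [LinearMap.add_apply]
  have h₁ : ∀ y j, g y = some j → (g y).getD i = j := fun y j h => by rw [h]; rfl
  have h₂ : ∀ y j, Equiv.swap none (some i) (g y) = some j → (g y).getD i = j := fun y j h => by
    rw [Equiv.swap_apply_eq_iff] at h
    by_cases hj : j = i
    · rw [hj, Equiv.swap_apply_right] at h
      rw [h, hj]; rfl
    · rw [Equiv.swap_apply_of_ne_of_ne (by simp) (by simpa using hj)] at h
      rw [h]; rfl
  by_cases h : ∃ σ : Equiv.Perm (Fin l), ∀ k, some ((g (f k)).getD i) = some (σ k)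
  · obtain ⟨σ, hσ⟩ := h
    rw [eval_tmk hσ]
    have hσ' : ∀ k, (g (f k)).getD i = σ k := fun k => Option.some_injective _ (hσ k)
    -- Only the point `σ⁻¹ i` can be affected by the merging. If `g` has the value `i` there, the
    -- first summand contributes `σ` and the second vanishes; if `g` is undefined there, the roles
    -- are exchanged.
    have hne : ∀ k, σ k ≠ i → g (f k) = some (σ k) := fun k hk => by
      have h3 := hσ' k
      cases hg : g (f k) with
      | none => rw [hg] at h3; exact absurd h3.symm hk
      | some j => rw [hg] at h3; exact congrArg some h3
    cases hg : g (f (σ.symm i)) with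
    | some j =>
      have hj : j = i := by
        have h3 := hσ' (σ.symm i)
        rw [hg, Equiv.apply_symm_apply] at h3
        exact h3
      rw [eval_tmk (σ := σ), eval_tmk_of_not, add_zero]
      · rintro ⟨τ, hτ⟩
        have h3 := hτ (σ.symm i)
        rw [hg, hj, Equiv.swap_apply_right] at h3
        exact Option.some_ne_none _ h3.symm
      · intro k
        by_cases hk : σ k = i
        · have hk' : k = σ.symm i := by rw [← hk, Equiv.symm_apply_apply]
          rw [hk, hk', hg, hj]
        · exact hne k hk
    | none =>
      rw [eval_tmk_of_not, eval_tmk (σ := σ), zero_add]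
      · intro k
        by_cases hk : σ k = i
        · have hk' : k = σ.symm i := by rw [← hk, Equiv.symm_apply_apply]
          rw [hk, hk', hg, Equiv.swap_apply_left]
        · rw [hne k hk, Equiv.swap_apply_of_ne_of_ne (by simp) (by simpa using hk)]
      · rintro ⟨τ, hτ⟩
        have h3 := hτ (σ.symm i)
        rw [hg] at h3
        exact Option.some_ne_none _ h3.symm
  · rw [eval_tmk_of_not h, eval_tmk_of_not, eval_tmk_of_not, add_zero]
    · exact fun ⟨σ, hσ⟩ => h ⟨σ, fun k => congrArg some (h₂ _ _ (hσ k))⟩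
    · exact fun ⟨σ, hσ⟩ => h ⟨σ, fun k => congrArg some (h₁ _ _ (hσ k))⟩

theorem eval_perm_comp (g : Fin n → Option (Fin l)) (τ : Equiv.Perm (Fin l))
    (x : ((Fin l ↪ Fin n) →₀ V) ⧸ balanced n ρ) :
    eval ρ (fun y => (g y).map τ) x = ρ τ (eval ρ g x) := by
  refine LinearMap.congr_fun (g := ρ τ ∘ₗ eval ρ g) (inducedRep_hom_ext fun f v => ?_) x
  rw [LinearMap.comp_apply]
  by_cases h : ∃ σ : Equiv.Perm (Fin l), ∀ k, g (f k) = some (σ k)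
  · obtain ⟨σ, hσ⟩ := h
    rw [eval_tmk hσ, eval_tmk (σ := τ * σ) (fun k => by rw [hσ]; rfl), map_mul]
    rfl
  · rw [eval_tmk_of_not h, eval_tmk_of_not, map_zero]
    rintro ⟨σ, hσ⟩
    refine h ⟨τ⁻¹ * σ, fun k => ?_⟩
    obtain ⟨j, hj, hj'⟩ := Option.map_eq_some_iff.1 (hσ k)
    rw [hj, Equiv.Perm.mul_apply, ← hj']
    simp

end Evaluation

/-! ### Coordinates indexed by increasing injections -/

section Coordinates

variable {n l : ℕ} {K V : Type*} [Field K] [AddCommGroup V] [Module K V]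
  (ρ : Representation K (Equiv.Perm (Fin l)) V)

/-- Sort the values. Increasing injections thus represent all orbits of the right action of the
symmetric group. -/
theorem exists_orderEmbedding (f : Fin l ↪ Fin n) :
    ∃ (h : Fin l ↪o Fin n) (σ : Equiv.Perm (Fin l)), f = σ.toEmbedding.trans h.toEmbedding := by
  have hm : StrictMono (f ∘ Tuple.sort f) :=
    (Tuple.monotone_sort f).strictMono_of_injective (f.injective.comp (Tuple.sort f).injective)
  refine ⟨OrderEmbedding.ofStrictMono _ hm, (Tuple.sort f).symm, ?_⟩
  ext k
  simp

/-- The reparametrization is itself increasing, hence the identity: distinct increasing injections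
lie in distinct orbits. -/
theorem orderEmbedding_eq {h h' : Fin l ↪o Fin n} {σ : Fin l → Fin l} (H : ∀ k, h (σ k) = h' k) :
    h = h' := by
  have hσ : StrictMono σ := fun i j hij => by
    rw [← h.lt_iff_lt, H, H]
    exact h'.strictMono hij
  have := eq_id_of_monotone_injective hσ.monotone hσ.injective
  subst this
  ext k
  rw [← H k]; rfl

theorem eval_partialInv_self (h : Fin l ↪o Fin n) (v : V) :
    eval ρ (Function.partialInv h) (tmk ρ h.toEmbedding v) = v := by
  rw [eval_tmk (σ := 1) fun k => Function.partialInv_left h.injective k, map_one]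
  rfl

theorem eval_partialInv_of_ne {h h' : Fin l ↪o Fin n} (hne : h ≠ h') (v : V) :
    eval ρ (Function.partialInv h) (tmk ρ h'.toEmbedding v) = 0 := by
  refine eval_tmk_of_not ?_ v
  rintro ⟨σ, hσ⟩
  exact hne (orderEmbedding_eq fun k => (h.injective.isPartialInv _ _).1 (hσ k))

/-- The induced representation is a direct sum of copies of `V`. -/
def inducedEquiv : (((Fin l ↪ Fin n) →₀ V) ⧸ balanced n ρ) ≃ₗ[K] ((Fin l ↪o Fin n) → V) := by
  refine LinearEquiv.ofLinearMap (LinearMap.pi fun h => eval ρ (Function.partialInv h))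
    (∑ h : Fin l ↪o Fin n, tmk ρ h.toEmbedding ∘ₗ LinearMap.proj h) ?_ ?_
  · refine LinearMap.ext fun y => funext fun h => ?_
    rw [LinearMap.comp_apply, LinearMap.pi_apply, LinearMap.sum_apply, map_sum,
      Finset.sum_eq_single h]
    · exact eval_partialInv_self ρ h (y h)
    · exact fun h' _ hne => eval_partialInv_of_ne ρ hne.symm (y h')
    · exact fun h' => absurd (Finset.mem_univ h) h'
  · refine inducedRep_hom_ext fun f v => ?_
    obtain ⟨h, σ, rfl⟩ := exists_orderEmbedding f
    rw [tmk_trans, LinearMap.comp_apply, LinearMap.sum_apply, Finset.sum_eq_single h]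
    · exact congrArg (tmk ρ h.toEmbedding) (eval_partialInv_self ρ h _)
    · intro h' _ hne
      exact (congrArg (tmk ρ h'.toEmbedding) (eval_partialInv_of_ne ρ hne _)).trans (map_zero _)
    · exact fun h' => absurd (Finset.mem_univ h) h'

theorem inducedEquiv_apply (x : ((Fin l ↪ Fin n) →₀ V) ⧸ balanced n ρ) (h : Fin l ↪o Fin n) :
    inducedEquiv ρ x h = eval ρ (Function.partialInv h) x := rfl

theorem card_orderEmbedding : Fintype.card (Fin l ↪o Fin n) = n.choose l := by
  rw [← Nat.card_eq_fintype_card, Nat.card_congr Set.powersetCard.ofFinEmbEquiv,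
    Set.powersetCard.card, Nat.card_eq_fintype_card, Fintype.card_fin]

end Coordinates

/-! ### The radical of the induced representation -/

section Radical

variable {n l : ℕ} {K V : Type*} [Field K] [AddCommGroup V] [Module K V]

/-- The vectors of the induced representation annihilated by the maps with `l` through strands. -/
def nullSub (n : ℕ) (ρ : Representation K (Equiv.Perm (Fin l)) V) :
    Subrepresentation (inducedRep n ρ) where
  toSubmodule := ⨅ g : Fin n → Fin l, LinearMap.ker (eval ρ fun y => some (g y))
  apply_mem_toSubmodule := fun a x hx => by
    rw [Submodule.mem_iInf] at hx ⊢
    intro g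
    rw [LinearMap.mem_ker, eval_inducedRep]
    exact hx fun y => g (a y)

variable {ρ : Representation K (Equiv.Perm (Fin l)) V}

theorem mem_nullSub {x : ((Fin l ↪ Fin n) →₀ V) ⧸ balanced n ρ} :
    x ∈ nullSub n ρ ↔ ∀ g : Fin n → Fin l, eval ρ (fun y => some (g y)) x = 0 :=
  Submodule.mem_iInf _

/-- The merged map in `eval_getD` is total, so the two summands cancel on a null vector. -/
theorem eval_swap_none {x : ((Fin l ↪ Fin n) →₀ V) ⧸ balanced n ρ} (hx : x ∈ nullSub n ρ)
    (g : Fin n → Option (Fin l)) (i : Fin l) :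
    eval ρ (fun y => Equiv.swap none (some i) (g y)) x = -eval ρ g x := by
  have h := eval_getD (ρ := ρ) g i x
  rw [mem_nullSub.1 hx] at h
  exact eq_neg_of_add_eq_zero_right h.symm

/-- On `Option (Fin l)`, `(p q) = (none p)(none q)(none p)`, and each of the three factors
contributes a sign. -/
theorem swap_eval {x : ((Fin l ↪ Fin n) →₀ V) ⧸ balanced n ρ} (hx : x ∈ nullSub n ρ)
    (g : Fin n → Option (Fin l)) {p q : Fin l} (hpq : p ≠ q) :
    ρ (Equiv.swap p q) (eval ρ g x) = -eval ρ g x := by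
  rw [← eval_perm_comp]
  have h : (fun y => (g y).map (Equiv.swap p q)) = fun y => Equiv.swap none (some p)
      (Equiv.swap none (some q) (Equiv.swap none (some p) (g y))) := by
    funext y
    cases g y with
    | none => simp [Equiv.swap_apply_def, hpq]
    | some j =>
      by_cases hp : j = p
      · subst hp; simp [Equiv.swap_apply_def, hpq.symm]
      · by_cases hq : j = q
        · subst hq; simp [Equiv.swap_apply_def, hp]
        · simp [Equiv.swap_apply_def, hp, hq]
  rw [h, eval_swap_none hx, eval_swap_none hx, eval_swap_none hx, neg_neg]

/-- An irreducible representation with a nonzero vector that is negated by the transpositions is the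
sign representation. -/
theorem nonempty_equiv_signRep (hρ : ρ.IsIrreducible) {w : V} (hw : w ≠ 0)
    (h : ∀ p q : Fin l, p ≠ q → ρ (Equiv.swap p q) w = -w) :
    Nonempty (ρ.Equiv (signRep K l)) := by
  have hσ : ∀ σ : Equiv.Perm (Fin l), ρ σ w = ((Equiv.Perm.sign σ : ℤ) : K) • w := fun σ => by
    induction σ using Equiv.Perm.swap_induction_on with
    | one => simp
    | swap_mul σ p q hpq ih =>
      rw [map_mul, Module.End.mul_apply, ih, map_smul, h p q hpq, Equiv.Perm.sign_mul,
        Equiv.Perm.sign_swap hpq]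
      simp
  have htop : Submodule.span K {w} = ⊤ := by
    refine top_unique ?_
    rw [← span_orbit_eq_top hρ hw, Submodule.span_le]
    rintro _ ⟨σ, rfl⟩
    exact Submodule.mem_span_singleton.2 ⟨_, (hσ σ).symm⟩
  let E : V ≃ₗ[K] K := ((LinearEquiv.toSpanNonzeroSingleton K V w hw) ≪≫ₗ
    LinearEquiv.ofTop _ htop).symm
  have hE : E.symm 1 = w := by simp [E]
  refine ⟨(Representation.Equiv.mk E.symm fun σ => ?_).symm⟩
  ext
  change E.symm (((Equiv.Perm.sign σ : ℤ) : K) • (1 : K)) = ρ σ (E.symm 1)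
  rw [map_smul, hE, hσ]

/-- A nonzero coordinate of a null vector would be negated by all transpositions and so span a copy
of the sign representation. -/
theorem nullSub_eq_bot (hρ : ρ.IsIrreducible) (hs : IsEmpty (ρ.Equiv (signRep K l))) :
    nullSub n ρ = ⊥ := by
  refine Subrepresentation.toSubmodule_injective (bot_unique fun x hx => ?_)
  refine (Submodule.mem_bot K).2 ((inducedEquiv ρ).map_eq_zero_iff.1 (funext fun h => ?_))
  rw [inducedEquiv_apply]
  by_contra h0
  exact hs.elim (nonempty_equiv_signRep hρ h0 fun p q hpq => swap_eval hx _ hpq).some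

variable {i : Fin l ↪ Fin n} {r : Fin n → Fin l}

theorem eval_retraction (hri : ∀ k, r (i k) = k) (v : V) : eval ρ (fun y => some (r y)) (tmk ρ i v) = v := by
  rw [eval_tmk (σ := 1) (fun k => by rw [hri]; rfl), map_one]
  rfl

/-- Pairings with total maps are thereby realized inside the monoid action. -/
theorem inducedRep_comp (g : Fin n → Fin l) (x : ((Fin l ↪ Fin n) →₀ V) ⧸ balanced n ρ) :
    inducedRep n ρ (i ∘ g : TMon n) x = tmk ρ i (eval ρ (fun y => some (g y)) x) := by
  refine LinearMap.congr_fun (g := tmk ρ i ∘ₗ eval ρ fun y => some (g y))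
    (inducedRep_hom_ext fun f v => ?_) x
  rw [LinearMap.comp_apply]
  by_cases h : Function.Injective (g ∘ f)
  · let σ : Equiv.Perm (Fin l) := Equiv.ofBijective _ (Finite.injective_iff_bijective.1 h)
    rw [eval_tmk (σ := σ) fun k => rfl, ← tmk_trans]
    exact inducedRep_tmk (a := (i ∘ g : TMon n)) (i.injective.comp h) v
  · rw [eval_tmk_of_not, map_zero]
    · exact inducedRep_tmk_of_not (a := (i ∘ g : TMon n))
        (fun h' => h (Function.Injective.of_comp (f := i) h')) v
    · rintro ⟨σ, hσ⟩
      refine h fun j k hjk => σ.injective (Option.some_injective _ ?_)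
      rw [← hσ, ← hσ]
      exact congrArg some hjk

theorem nullSub_ne_top (hri : ∀ k, r (i k) = k) (hρ : ρ.IsIrreducible) : nullSub n ρ ≠ ⊤ := fun h => by
  have := nontrivial_of_irreducible hρ
  obtain ⟨v, hv⟩ := exists_ne (0 : V)
  have h1 : tmk ρ i v ∈ nullSub n ρ := by rw [h]; exact Submodule.mem_top (R := K)
  have h2 := mem_nullSub.1 h1 r
  rw [eval_retraction hri] at h2
  exact hv h2

/-- Some `i ∘ g` moves an element of `U` to `i ⊗ w` with `w ≠ 0`. The maps `i ∘ σ ∘ r` and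
irreducibility of `ρ` give all of `i ⊗ V`, and `f ∘ r` carries `i ⊗ v` to `f ⊗ v`. -/
theorem eq_top_of_not_le_nullSub (hri : ∀ k, r (i k) = k) (hρ : ρ.IsIrreducible)
    (U : Subrepresentation (inducedRep n ρ)) (hU : ¬ U ≤ nullSub n ρ) : U = ⊤ := by
  obtain ⟨x, hx, hx0⟩ := SetLike.not_le_iff_exists.1 hU
  rw [mem_nullSub] at hx0
  push Not at hx0
  obtain ⟨g, hg⟩ := hx0
  have h1 : tmk ρ i (eval ρ (fun y => some (g y)) x) ∈ U.toSubmodule := by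
    rw [← inducedRep_comp]
    exact U.apply_mem_toSubmodule _ hx
  have h2 : ∀ w : V, tmk ρ i w ∈ U.toSubmodule := fun w => by
    have hle : Submodule.span K (Set.range fun σ => ρ σ (eval ρ (fun y => some (g y)) x)) ≤
        U.toSubmodule.comap (tmk ρ i) := by
      rw [Submodule.span_le]
      rintro _ ⟨σ, rfl⟩
      have h3 := U.apply_mem_toSubmodule (i ∘ (σ ∘ r) : TMon n) h1
      rw [inducedRep_comp, eval_tmk (σ := σ) (fun k => by
        rw [Function.comp_apply, hri])] at h3
      exact h3
    rw [span_orbit_eq_top hρ hg] at hle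
    exact hle (Submodule.mem_top (x := w))
  refine Subrepresentation.toSubmodule_injective (top_unique ?_)
  have h4 : ∀ f v, tmk ρ f v ∈ U.toSubmodule := fun f v => by
    have hf : ((f ∘ r : TMon n) : Fin n → Fin n) ∘ i = f := funext fun k => congrArg f (hri k)
    have hinj : Function.Injective ((f ∘ r : TMon n) ∘ i) := by
      rw [hf]; exact f.injective
    have h5 := U.apply_mem_toSubmodule (f ∘ r : TMon n) (h2 v)
    rw [inducedRep_tmk hinj] at h5
    have h6 : (⟨(f ∘ r : TMon n) ∘ i, hinj⟩ : Fin l ↪ Fin n) = f :=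
      Function.Embedding.ext fun k => congrFun hf k
    rwa [h6] at h5
  have h7 : U.toSubmodule.mkQ = 0 := inducedRep_hom_ext fun f v => by
    rw [LinearMap.zero_apply]
    exact (Submodule.Quotient.mk_eq_zero _).2 (h4 f v)
  intro x _
  exact (Submodule.Quotient.mk_eq_zero _).1 (LinearMap.congr_fun h7 x)

end Radical

/-! ### Alternating maps under a change of arguments -/

section Alternating

variable {R M N ι : Type*} [CommRing R] [AddCommGroup M] [Module R M] [AddCommGroup N] [Module R N]
  [Fintype ι] [DecidableEq ι]

/-- Pulled back along the linear combinations of `v`, `g` becomes an alternating map on `ι → R` with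
`ι` arguments, that is, a multiple of the determinant. -/
theorem alternatingMap_matrix (g : M [⋀^ι]→ₗ[R] N) (A : Matrix ι ι R) (v : ι → M) :
    g (fun k => ∑ j, A k j • v j) = A.det • g v := by
  let h : (ι → R) [⋀^ι]→ₗ[R] N := g.compLinearMap (Fintype.linearCombination R v)
  have h1 : h = ((LinearMap.toSpanSingleton R N (h fun k => Pi.basisFun R ι k)).compAlternatingMap
      (Pi.basisFun R ι).det) := by
    refine Module.Basis.ext_alternating (Pi.basisFun R ι) fun s hs => ?_
    let σ : Equiv.Perm ι := Equiv.ofBijective s (Finite.injective_iff_bijective.1 hs)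
    have h2 : (fun k => Pi.basisFun R ι (s k)) = (fun k => Pi.basisFun R ι k) ∘ σ := rfl
    rw [h2, AlternatingMap.map_perm, LinearMap.compAlternatingMap_apply, AlternatingMap.map_perm]
    have h3 : (Pi.basisFun R ι).det (fun k => Pi.basisFun R ι k) = 1 := Module.Basis.det_self _
    rw [h3]
    rcases Int.units_eq_one_or (Equiv.Perm.sign σ) with h4 | h4 <;> rw [h4] <;> simp
  have h5 : h A = (Pi.basisFun R ι).det A • h fun k => Pi.basisFun R ι k := DFunLike.congr_fun h1 A
  have h8 : (Pi.basisFun R ι).det A = A.det := Pi.basisFun_det_apply A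
  have h6 : h A = g (fun k => ∑ j, A k j • v j) := rfl
  have h7 : (h fun k => Pi.basisFun R ι k) = g v := by
    refine congrArg g (funext fun k => ?_)
    simp [Fintype.linearCombination_apply, Pi.single_apply]
  rw [h6, h7, h8] at h5
  exact h5

end Alternating

/-! ### Alternating maps of differences of points -/

section Differences

variable {K E P : Type*} [Field K] [AddCommGroup E] [Module K E] [AddCommGroup P] [Module K P]
  {m : ℕ}

/-- By telescoping, the change of differences is lower triangular with ones on the diagonal. -/
theorem alternating_consecutive (g : E [⋀^Fin m]→ₗ[K] P) (x : Fin (m + 1) → E) :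
    g (fun k => x k.succ - x 0) = g (fun k => x k.succ - x k.castSucc) := by
  let A : Matrix (Fin m) (Fin m) K := fun k j => if j ≤ k then 1 else 0
  have hA : A.det = 1 := by
    rw [Matrix.det_of_isLowerTriangular A fun i j hij => if_neg (not_le.2 hij)]
    simp [A]
  rw [← one_smul K (g fun k => x k.succ - x k.castSucc), ← hA, ← alternatingMap_matrix]
  congr 1
  funext k
  have h : ∀ k : Fin (m + 1), x k - x 0 =
      ∑ j : Fin m, if j.castSucc < k then x j.succ - x j.castSucc else 0 := fun k => by
    induction k using Fin.induction with
    | zero => simp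
    | succ k ih =>
      have h1 : ∀ j : Fin m, (if j.castSucc < k.succ then x j.succ - x j.castSucc else 0) =
          (if j.castSucc < k.castSucc then x j.succ - x j.castSucc else 0) +
            if j = k then x k.succ - x k.castSucc else 0 := fun j => by
        rcases lt_trichotomy j k with hj | rfl | hj
        · simp [hj, hj.ne, Fin.castSucc_lt_succ_iff, hj.le]
        · simp [Fin.castSucc_lt_succ_iff]
        · simp [hj.ne', Fin.castSucc_lt_succ_iff, not_le.2 hj, not_lt.2 hj.le]
      rw [Finset.sum_congr rfl fun j _ => h1 j, Finset.sum_add_distrib, ← ih]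
      simp
  rw [h]
  refine Finset.sum_congr rfl fun j _ => ?_
  simp [A, Fin.castSucc_lt_succ_iff, ite_smul]

/-- A transposition fixing the base point `0` swaps two arguments; one moving it is a rank-one
change of the identity with determinant `-1`. -/
theorem alternating_perm (g : E [⋀^Fin m]→ₗ[K] P) (x : Fin (m + 1) → E)
    (σ : Equiv.Perm (Fin (m + 1))) :
    g (fun k => x (σ k.succ) - x (σ 0)) =
      ((Equiv.Perm.sign σ : ℤ) : K) • g (fun k => x k.succ - x 0) := by
  have h0 : ∀ (x : Fin (m + 1) → E) (p : Fin m),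
      g (fun k => x (Equiv.swap 0 p.succ k.succ) - x (Equiv.swap 0 p.succ 0)) =
        -g fun k => x k.succ - x 0 := fun x p => by
    -- With `d k = x k.succ - x 0`, the new differences are `d k - d p` for `k ≠ p` and `-d p = d p
    -- - 2 d p` for `k = p`; the determinant is `1 + c p`.
    let c : Fin m → K := fun k => if k = p then -2 else -1
    let A : Matrix (Fin m) (Fin m) K := 1 + Matrix.vecMulVec c (Pi.single p 1)
    have hA : A.det = -1 := by
      simp only [A]
      rw [Matrix.vecMulVec_eq Unit, Matrix.det_one_add_replicateCol_mul_replicateRow]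
      simp [c]; norm_num
    rw [← neg_one_smul K (g fun k => x k.succ - x 0), ← hA, ← alternatingMap_matrix]
    congr 1
    funext k
    have h1 : ∀ j, A k j • (x j.succ - x 0) = (if k = j then x k.succ - x 0 else 0) +
        if p = j then c k • (x p.succ - x 0) else 0 := fun j => by
      simp only [A, Matrix.add_apply, Matrix.one_apply, Matrix.vecMulVec_apply, add_smul,
        Pi.single_apply]
      congr 1
      · by_cases h : k = j
        · subst h; simp
        · simp [h]
      · by_cases h : p = j
        · subst h; simp
        · simp [h, Ne.symm h]
    rw [Finset.sum_congr rfl fun j _ => h1 j, Finset.sum_add_distrib, Finset.sum_ite_eq,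
      Finset.sum_ite_eq, if_pos (Finset.mem_univ _), if_pos (Finset.mem_univ _),
      Equiv.swap_apply_left]
    by_cases h : k = p
    · subst h
      simp only [c, if_true, Equiv.swap_apply_right]
      rw [neg_smul, two_smul]
      abel
    · rw [Equiv.swap_apply_of_ne_of_ne (Fin.succ_ne_zero k) (fun h' => h (Fin.succ_injective _ h'))]
      simp only [c, if_neg h, neg_smul, one_smul]
      abel
  have h1 : ∀ (x : Fin (m + 1) → E) (p q : Fin (m + 1)), p ≠ q →
      g (fun k => x (Equiv.swap p q k.succ) - x (Equiv.swap p q 0)) =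
        -g fun k => x k.succ - x 0 := fun x p q hpq => by
    rcases Fin.eq_zero_or_eq_succ p with rfl | ⟨p, rfl⟩
    · rcases Fin.eq_zero_or_eq_succ q with rfl | ⟨q, rfl⟩
      · exact absurd rfl hpq
      · exact h0 x q
    · rcases Fin.eq_zero_or_eq_succ q with rfl | ⟨q, rfl⟩
      · rw [Equiv.swap_comm]
        exact h0 x p
      · have hpq' : p ≠ q := fun h => hpq (congrArg Fin.succ h)
        rw [← g.map_swap _ hpq']
        congr 1
        funext k
        rw [Equiv.swap_apply_of_ne_of_ne (Fin.succ_ne_zero p).symm (Fin.succ_ne_zero q).symm,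
          Function.comp_apply, (Fin.succ_injective m).swap_apply]
  induction σ using Equiv.Perm.swap_induction_on' generalizing x with
  | one => simp
  | mul_swap σ p q hpq ih =>
    have h2 := h1 (x ∘ σ) p q hpq
    refine h2.trans ?_
    rw [Equiv.Perm.sign_mul, Equiv.Perm.sign_swap hpq]
    have h3 := ih x
    simp only [Function.comp_apply]
    rw [h3]
    simp

end Differences

/-! ### The reflection representation and its exterior powers -/

section Reflection

variable (K : Type*) [Field K] {n : ℕ}

/-- The vector `e_i - e_j` of the reflection representation. -/
def delta (i j : Fin n) : SumZero K n :=
  ⟨Finsupp.single i 1 - Finsupp.single j 1, by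
    rw [LinearMap.mem_ker, map_sub]
    simp [coordSum]⟩

theorem reflectionRep_delta (a : TMon n) (i j : Fin n) :
    reflectionRep K n a (delta K i j) = delta K (a i) (a j) := by
  refine Subtype.ext ?_
  have h : ∀ k, naturalRep K n a (Finsupp.single k 1) = Finsupp.single (a k) 1 := fun _ =>
    Finsupp.mapDomain_single
  change naturalRep K n a (Finsupp.single i 1 - Finsupp.single j 1) = _
  rw [map_sub, h, h]
  rfl

theorem delta_self (i : Fin n) : delta K i i = 0 := Subtype.ext (sub_self _)

theorem delta_sub_delta (i j k : Fin n) : delta K i k - delta K j k = delta K i j :=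
  Subtype.ext (sub_sub_sub_cancel_right _ _ _)

theorem span_delta_zero (N : ℕ) :
    Submodule.span K (Set.range fun i : Fin N => delta K i.succ 0) = ⊤ := by
  refine top_unique fun x _ => ?_
  have hx : ∑ i : Fin (N + 1), x.1 i = 0 := by
    have := x.2
    rwa [LinearMap.mem_ker, coordSum, Finsupp.lsum_apply, Finsupp.sum_fintype _ _ (by simp)] at this
  have h : x = ∑ i : Fin N, x.1 i.succ • delta K i.succ 0 := by
    refine Subtype.ext (Finsupp.ext fun j => ?_)
    rw [AddSubmonoidClass.coe_finsetSum, Finsupp.finsetSum_apply]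
    have h1 : ∀ i : Fin N, ((x.1 i.succ • delta K i.succ 0 : SumZero K (N + 1)) :
        Fin (N + 1) →₀ K) j = x.1 i.succ * ((if i.succ = j then 1 else 0) -
          if 0 = j then 1 else 0) := fun i => by
      change x.1 i.succ * (Finsupp.single i.succ (1 : K) j - Finsupp.single 0 (1 : K) j) = _
      rw [Finsupp.single_apply, Finsupp.single_apply]
    rw [Finset.sum_congr rfl fun i _ => h1 i]
    rw [Fin.sum_univ_succ] at hx
    rcases Fin.eq_zero_or_eq_succ j with rfl | ⟨j, rfl⟩
    · simp [Fin.succ_ne_zero]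
      exact eq_neg_of_add_eq_zero_left hx
    · simp [(Fin.succ_ne_zero _).symm]
  rw [h]
  exact Submodule.sum_mem _ fun i _ => Submodule.smul_mem _ _ (Submodule.subset_span ⟨i, rfl⟩)

theorem span_delta_succ (N : ℕ) :
    Submodule.span K (Set.range fun i : Fin N => delta K i.succ i.castSucc) = ⊤ := by
  refine top_unique ?_
  rw [← span_delta_zero, Submodule.span_le]
  rintro _ ⟨i, rfl⟩
  suffices h : ∀ j : Fin (N + 1), delta K j 0 ∈
      Submodule.span K (Set.range fun i : Fin N => delta K i.succ i.castSucc) from h i.succ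
  intro j
  induction j using Fin.induction with
  | zero => rw [delta_self]; exact zero_mem _
  | succ j ih =>
    have h : delta K j.succ j.castSucc + delta K j.castSucc 0 ∈
        Submodule.span K (Set.range fun i : Fin N => delta K i.succ i.castSucc) :=
      add_mem (Submodule.subset_span ⟨j, rfl⟩) ih
    have h' : delta K j.succ j.castSucc + delta K j.castSucc 0 = delta K j.succ 0 :=
      Subtype.ext (sub_add_sub_cancel _ _ _)
    rwa [h'] at h

theorem finrank_sumZero (N : ℕ) : Module.finrank K (SumZero K (N + 1)) = N := by
  have hs : Function.Surjective (coordSum K (N + 1)) := fun c =>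
    ⟨Finsupp.single 0 c, by simp [coordSum]⟩
  have h := LinearMap.finrank_range_add_finrank_ker (coordSum K (N + 1))
  rw [LinearMap.range_eq_top.2 hs, finrank_top, Module.finrank_self, Module.finrank_finsupp_self,
    Fintype.card_fin] at h
  change Module.finrank K (LinearMap.ker (coordSum K (N + 1))) = N
  omega

variable {m : ℕ}

/-- The exterior product of the vectors `e_(x k) - e_(x 0)`. -/
def wedge (x : Fin (m + 1) → Fin n) : ⋀[K]^m (SumZero K n) :=
  exteriorPower.ιMulti K m fun k => delta K (x k.succ) (x 0)

/-- The vectors `e_i` do not have coordinate sum zero; subtracting an auxiliary `e_o` lets the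
lemmas on differences apply inside the reflection representation. -/
theorem wedge_eq_sub (x : Fin (m + 1) → Fin n) (o : Fin n) :
    wedge K x = exteriorPower.ιMulti K m fun k => delta K (x k.succ) o - delta K (x 0) o :=
  congrArg (exteriorPower.ιMulti K m) (funext fun _ => (delta_sub_delta K _ _ _).symm)

theorem wedge_comp_perm (x : Fin (m + 1) → Fin n) (σ : Equiv.Perm (Fin (m + 1))) :
    wedge K (x ∘ σ) = ((Equiv.Perm.sign σ : ℤ) : K) • wedge K x := by
  rw [wedge_eq_sub K _ (x 0), wedge_eq_sub K _ (x 0)]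
  exact alternating_perm (exteriorPower.ιMulti K m) (fun k => delta K (x k) (x 0)) σ

theorem wedge_eq_consecutive (x : Fin (m + 1) → Fin n) :
    wedge K x = exteriorPower.ιMulti K m fun k => delta K (x k.succ) (x k.castSucc) := by
  rw [wedge_eq_sub K _ (x 0)]
  refine (alternating_consecutive (exteriorPower.ιMulti K m) fun k => delta K (x k) (x 0)).trans ?_
  exact congrArg (exteriorPower.ιMulti K m) (funext fun _ => delta_sub_delta K _ _ _)

theorem exteriorReflectionRep_ιMulti (a : TMon n) (y : Fin m → SumZero K n) :
    exteriorReflectionRep K n m a (exteriorPower.ιMulti K m y) =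
      exteriorPower.ιMulti K m fun k => reflectionRep K n a (y k) :=
  exteriorPower.map_apply_ιMulti _ _

theorem exteriorReflectionRep_wedge (a : TMon n) (x : Fin (m + 1) → Fin n) :
    exteriorReflectionRep K n m a (wedge K x) = wedge K (a ∘ x) := by
  rw [wedge, exteriorReflectionRep_ιMulti]
  exact congrArg (exteriorPower.ιMulti K m) (funext fun _ => reflectionRep_delta K _ _ _)

theorem wedge_eq_zero {x : Fin (m + 1) → Fin n} (hx : ¬ Function.Injective x) :
    wedge K x = 0 := by
  obtain ⟨i, j, hij, hne⟩ := Function.not_injective_iff.1 hx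
  have key : ∀ j : Fin m, x j.succ = x 0 → wedge K x = 0 := fun j h =>
    (exteriorPower.ιMulti K m).map_coord_zero j (by rw [h, delta_self])
  rcases Fin.eq_zero_or_eq_succ i with rfl | ⟨i, rfl⟩
  · rcases Fin.eq_zero_or_eq_succ j with rfl | ⟨j, rfl⟩
    · exact absurd rfl hne
    · exact key j hij.symm
  · rcases Fin.eq_zero_or_eq_succ j with rfl | ⟨j, rfl⟩
    · exact key i hij
    · exact (exteriorPower.ιMulti K m).map_eq_zero_of_eq _ (i := i) (j := j) (by rw [hij])
        fun h => hne (congrArg Fin.succ h)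

theorem span_wedge_monotone (N m : ℕ) : Submodule.span K
    (Set.range fun x : {x : Fin (m + 1) → Fin (N + 1) // Monotone x} => wedge K x.1) = ⊤ := by
  refine top_unique ?_
  rw [← exteriorPower.ιMulti_family_span_of_span K (n := m) (span_delta_zero K N)]
  refine Submodule.span_mono ?_
  rintro _ ⟨D, rfl⟩
  let d := Set.powersetCard.ofFinEmbEquiv.symm D
  -- The basis wedge of the vectors `e_(d k + 1) - e_0` is the wedge of the monotone sequence `0, d
  -- 0 + 1, d 1 + 1, …`.
  have hm : Monotone (Fin.cons 0 (Fin.succ ∘ d) : Fin (m + 1) → Fin (N + 1)) := by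
    refine Fin.monotone_iff_le_succ.2 fun k => ?_
    rw [Fin.cons_succ]
    rcases Fin.eq_zero_or_eq_succ k.castSucc with h | ⟨j, h⟩
    · rw [h]; exact Fin.zero_le _
    · rw [h, Fin.cons_succ]
      refine Fin.succ_le_succ_iff.2 (d.monotone ?_)
      have h1 : (k : ℕ) = j + 1 := congrArg Fin.val h
      exact Fin.le_def.2 (by omega)
  refine ⟨⟨_, hm⟩, ?_⟩
  refine congrArg (exteriorPower.ιMulti K m) (funext fun k => ?_)
  rfl

theorem finrank_exterior (N m : ℕ) :
    Module.finrank K (⋀[K]^m (SumZero K (N + 1))) = N.choose m := by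
  have : Module.Free K (SumZero K (N + 1)) := Module.Free.of_divisionRing K (SumZero K (N + 1))
  rw [exteriorPower.finrank_eq, finrank_sumZero]

end Reflection

/-! ### Simplicity of the exterior powers over the planar monoid -/

section Irreducible

variable (K : Type*) [Field K] {N m : ℕ}

/-- The number of elements of a set that lie strictly to the left of `x`. -/
def cut (d : Fin m ↪o Fin N) (x : Fin (N + 1)) : Fin (m + 1) :=
  ⟨(Finset.univ.filter fun k => (d k).castSucc < x).card,
    Nat.lt_succ_of_le ((Finset.card_le_univ _).trans (Fintype.card_fin m).le)⟩

theorem cut_monotone (d : Fin m ↪o Fin N) : Monotone (cut d) := fun x y h => by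
  change (Finset.univ.filter fun k => (d k).castSucc < x).card ≤
    (Finset.univ.filter fun k => (d k).castSucc < y).card
  refine Finset.card_le_card fun k => ?_
  simp only [Finset.mem_filter, Finset.mem_univ, true_and]
  exact fun h' => h'.trans_le h

/-- An element `j` of `Fin N` stands for the gap between `j.castSucc` and `j.succ`; `cut d` rises by
one across the gaps in `d` and is constant across the others. -/
theorem cut_castSucc (d : Fin m ↪o Fin N) (k : Fin m) : cut d (d k).castSucc = k.castSucc := by
  refine Fin.ext ?_
  have h : (Finset.univ.filter fun j => (d j).castSucc < (d k).castSucc) = Finset.Iio k := by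
    ext j
    simp
  change (Finset.univ.filter fun j => (d j).castSucc < (d k).castSucc).card = _
  rw [h, Fin.card_Iio]
  rfl

theorem cut_succ (d : Fin m ↪o Fin N) (k : Fin m) : cut d (d k).succ = k.succ := by
  refine Fin.ext ?_
  have h : (Finset.univ.filter fun j => (d j).castSucc < (d k).succ) = Finset.Iic k := by
    ext j
    simp [Fin.castSucc_lt_succ_iff]
  change (Finset.univ.filter fun j => (d j).castSucc < (d k).succ).card = _
  rw [h, Fin.card_Iic]
  rfl

theorem cut_succ_eq (d : Fin m ↪o Fin N) {i : Fin N} (hi : i ∉ Set.range d) :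
    cut d i.succ = cut d i.castSucc := by
  refine Fin.ext ?_
  change (Finset.univ.filter fun k => (d k).castSucc < i.succ).card =
    (Finset.univ.filter fun k => (d k).castSucc < i.castSucc).card
  refine congrArg Finset.card (Finset.filter_congr fun j _ => ?_)
  rw [Fin.castSucc_lt_succ_iff, Fin.castSucc_lt_castSucc_iff]
  exact ⟨fun h => lt_of_le_of_ne h fun h' => hi ⟨j, h'⟩, le_of_lt⟩

variable {i : Fin (m + 1) → Fin (N + 1)} {r : Fin (N + 1) → Fin (m + 1)}

/-- If `D' ≠ D`, equality of sizes gives a gap in `D'` outside `D`; its difference vector is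
collapsed to zero. So these monotone maps read off single coefficients. -/
theorem exterior_cut (i : Fin (m + 1) → Fin (N + 1)) (D D' : Set.powersetCard (Fin N) m) :
    exteriorReflectionRep K (N + 1) m
        (i ∘ cut (Set.powersetCard.ofFinEmbEquiv.symm D) : TMon (N + 1))
        (exteriorPower.ιMulti_family K m (fun j : Fin N => delta K j.succ j.castSucc) D') =
      if D' = D then wedge K i else 0 := by
  let d := Set.powersetCard.ofFinEmbEquiv.symm D
  let d' := Set.powersetCard.ofFinEmbEquiv.symm D'
  refine (exteriorReflectionRep_ιMulti K _ fun k => delta K (d' k).succ (d' k).castSucc).trans ?_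
  split_ifs with h
  · rw [wedge_eq_consecutive]
    refine congrArg (exteriorPower.ιMulti K m) (funext fun k => ?_)
    have hd : d' = d := congrArg Set.powersetCard.ofFinEmbEquiv.symm h
    rw [hd]
    refine (reflectionRep_delta K _ _ _).trans ?_
    change delta K (i (cut d (d k).succ)) (i (cut d (d k).castSucc)) = _
    rw [cut_succ, cut_castSucc]
  · obtain ⟨j, hj', hj⟩ := (Set.powersetCard.exists_mem_notMem_iff_ne D' D).1 h
    obtain ⟨k, rfl⟩ := (Set.powersetCard.mem_range_ofFinEmbEquiv_symm_iff_mem D' j).2 hj'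
    refine (exteriorPower.ιMulti K m).map_coord_zero k ?_
    refine (reflectionRep_delta K _ _ _).trans ?_
    change delta K (i (cut d (d' k).succ)) (i (cut d (d' k).castSucc)) = 0
    rw [cut_succ_eq, delta_self]
    exact fun h' => hj ((Set.powersetCard.mem_range_ofFinEmbEquiv_symm_iff_mem D _).1 h')

/-- The exterior powers of the reflection representation as representations of the planar monoid. -/
def planarExterior (N m : ℕ) :
    Representation K (PTMon (N + 1)) (⋀[K]^m (SumZero K (N + 1))) :=
  (exteriorReflectionRep K (N + 1) m).comp (PTMon (N + 1)).subtype

theorem nontrivial_exterior (hm : m ≤ N) : Nontrivial (⋀[K]^m (SumZero K (N + 1))) :=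
  Module.nontrivial_of_finrank_pos (R := K) (by
    rw [finrank_exterior]; exact Nat.choose_pos hm)

/-- Every wedge is the image of this one under `x ∘ r`, and the wedges span a nonzero space. -/
theorem wedge_ne_zero (hm : m ≤ N) (hr : ∀ k, r (i k) = k) : wedge K i ≠ 0 := fun h => by
  have := nontrivial_exterior K hm
  have h1 : ∀ x : Fin (m + 1) → Fin (N + 1), wedge K x = 0 := fun x => by
    have h2 := exteriorReflectionRep_wedge K (x ∘ r : TMon (N + 1)) i
    rw [h, map_zero] at h2
    have h3 : ((x ∘ r : TMon (N + 1)) : Fin (N + 1) → Fin (N + 1)) ∘ i = x :=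
      funext fun k => congrArg x (hr k)
    rw [h3] at h2
    exact h2.symm
  have h4 := span_wedge_monotone K N m
  rw [Submodule.span_eq_bot.2 (by rintro _ ⟨x, rfl⟩; exact h1 x.1)] at h4
  exact bot_ne_top h4

/-- A cut at a basis element with nonzero coefficient produces `wedge K i`, and the monotone maps `x
∘ r` turn it into a spanning family. -/
theorem planarExterior_irreducible (hm : m ≤ N) (hi : Monotone i) (hr : Monotone r)
    (hri : ∀ k, r (i k) = k) : (planarExterior K N m).IsIrreducible := by
  have := nontrivial_exterior K hm
  refine irreducible_of_span_orbit fun y hy => ?_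
  have htop := exteriorPower.ιMulti_family_span_of_span (R := K) (M := SumZero K (N + 1)) (n := m)
    (span_delta_succ K N)
  obtain ⟨c, hc⟩ := (Submodule.mem_span_range_iff_exists_fun K).1
    (show y ∈ Submodule.span K _ from htop ▸ Submodule.mem_top)
  obtain ⟨D, hD⟩ : ∃ D, c D ≠ 0 := by
    by_contra! h
    exact hy (by rw [← hc]; simp [h])
  have h1 : wedge K i ∈ (orbitSpan (planarExterior K N m) y).toSubmodule := by
    have h2 := (orbitSpan (planarExterior K N m) y).apply_mem_toSubmodule
      (planar (hi.comp (cut_monotone (Set.powersetCard.ofFinEmbEquiv.symm D))))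
      (mem_orbitSpan_self (planarExterior K N m) y)
    have h3 : planarExterior K N m
        (planar (hi.comp (cut_monotone (Set.powersetCard.ofFinEmbEquiv.symm D)))) y =
          c D • wedge K i := by
      rw [← hc, map_sum, Finset.sum_eq_single D]
      · rw [map_smul]
        refine congrArg (c D • ·) ((exterior_cut K i D D).trans (if_pos rfl))
      · intro D' _ hD'
        rw [map_smul]
        refine (congrArg (c D' • ·) ((exterior_cut K i D D').trans (if_neg hD'))).trans ?_
        exact smul_zero _
      · exact fun h => absurd (Finset.mem_univ D) h
    rw [h3] at h2
    exact (Submodule.smul_mem_iff _ hD).1 h2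
  refine top_unique ?_
  rw [← span_wedge_monotone K N m, Submodule.span_le]
  rintro _ ⟨⟨x, hx⟩, rfl⟩
  have h4 := (orbitSpan (planarExterior K N m) y).apply_mem_toSubmodule (planar (hx.comp hr)) h1
  have h5 : planarExterior K N m (planar (hx.comp hr)) (wedge K i) = wedge K x := by
    refine (exteriorReflectionRep_wedge K _ i).trans (congrArg (wedge K) (funext fun k => ?_))
    exact congrArg x (hri k)
  rw [h5] at h4
  exact h4

theorem exteriorReflectionRep_irreducible (hm : m ≤ N) (hi : Monotone i) (hr : Monotone r)
    (hri : ∀ k, r (i k) = k) : (exteriorReflectionRep K (N + 1) m).IsIrreducible :=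
  irreducible_of_comp _ _ (planarExterior_irreducible K hm hi hr hri)

theorem exteriorReflectionRep_eq_zero {a : TMon (N + 1)} (ha : throughStrands a < m + 1) :
    exteriorReflectionRep K (N + 1) m a = 0 := by
  refine LinearMap.ext_on_range (span_wedge_monotone K N m) fun x => ?_
  rw [exteriorReflectionRep_wedge, wedge_eq_zero K (not_injective_comp ha x.1)]
  rfl

end Irreducible

/-! ### Simplicity, apex and dimension of the heads -/

section SimpleModules

variable {K V : Type*} [Field K] [AddCommGroup V] [Module K V] {n l : ℕ}
  {ρ : Representation K (Equiv.Perm (Fin l)) V} {i : Fin l ↪ Fin n} {r : Fin n → Fin l}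

theorem finite_of_irreducible {S : Type*} [Monoid S] [Finite S] {π : Representation K S V}
    (hπ : π.IsIrreducible) : Module.Finite K V := by
  have := nontrivial_of_irreducible hπ
  obtain ⟨v, hv⟩ := exists_ne (0 : V)
  exact ⟨⟨(Set.finite_range fun s => π s v).toFinset, by
    rw [Set.Finite.coe_toFinset]; exact span_orbit_eq_top hπ hv⟩⟩

theorem simpleRep_irreducible (hri : ∀ k, r (i k) = k) (hρ : ρ.IsIrreducible) :
    (simpleRep n ρ).IsIrreducible :=
  head_irreducible (nullSub_ne_top hri hρ) (eq_top_of_not_le_nullSub hri hρ)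

theorem simpleRep_isApex (hl : 1 ≤ l) (hri : ∀ k, r (i k) = k) (hρ : ρ.IsIrreducible) :
    IsApex (simpleRep n ρ) (tCell n l) := by
  refine isApex_of (isStrandCell_id hl hri) (fun h => ?_) fun b hb => ?_
  · have := nontrivial_of_irreducible hρ
    obtain ⟨v, hv⟩ := exists_ne (0 : V)
    have h1 : simpleRep n ρ (i ∘ r : TMon n) (Submodule.Quotient.mk (tmk ρ i v)) =
        Submodule.Quotient.mk (tmk ρ i v) := by
      refine (head_apply_mk _ _).trans (congrArg _ ?_)
      rw [inducedRep_comp, eval_retraction hri]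
    rw [h, LinearMap.zero_apply, eq_comm, Submodule.Quotient.mk_eq_zero,
      radical_eq (nullSub_ne_top hri hρ) (eq_top_of_not_le_nullSub hri hρ)] at h1
    have h2 := mem_nullSub.1 h1 r
    rw [eval_retraction hri] at h2
    exact hv h2
  · have h0 : inducedRep n ρ b = 0 := inducedRep_hom_ext fun f v =>
      inducedRep_tmk_of_not (not_injective_comp hb f) v
    refine LinearMap.ext fun x => ?_
    obtain ⟨x, rfl⟩ := Submodule.Quotient.mk_surjective _ x
    refine (head_apply_mk _ _).trans ?_
    rw [h0]
    rfl

theorem finite_simpleSpace (hρ : ρ.IsIrreducible) : Module.Finite K (SimpleSpace n ρ) := by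
  have := finite_of_irreducible hρ
  infer_instance

theorem finrank_simpleSpace (hri : ∀ k, r (i k) = k) (hρ : ρ.IsIrreducible)
    (hs : IsEmpty (ρ.Equiv (signRep K l))) :
    Module.finrank K (SimpleSpace n ρ) = n.choose l * Module.finrank K V := by
  have hr : (radical (inducedRep n ρ)).toSubmodule = ⊥ := by
    rw [radical_eq (nullSub_ne_top hri hρ) (eq_top_of_not_le_nullSub hri hρ),
      nullSub_eq_bot hρ hs]
    rfl
  have := finite_of_irreducible hρ
  rw [((Submodule.quotEquivOfEqBot _ hr) ≪≫ₗ inducedEquiv ρ).finrank_eq,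
    Module.finrank_pi_fintype, Finset.sum_const, Finset.card_univ, card_orderEmbedding,
    smul_eq_mul]

end SimpleModules

/-! ### The sign case: comparison with the exterior power -/

section Sign

variable {K V : Type*} [Field K] [AddCommGroup V] [Module K V] {N m : ℕ}
  {ρ : Representation K (Equiv.Perm (Fin (m + 1))) V}

theorem signRep_balanced (θ : ρ.Equiv (signRep K (m + 1))) (f : Fin (m + 1) ↪ Fin (N + 1))
    (σ : Equiv.Perm (Fin (m + 1))) (v : V) :
    (LinearMap.toSpanSingleton K _ (wedge K (σ.toEmbedding.trans f)) ∘ₗ θ.toLinearMap) v =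
      (LinearMap.toSpanSingleton K _ (wedge K f) ∘ₗ θ.toLinearMap) (ρ σ v) := by
  have h : θ (ρ σ v) = ((Equiv.Perm.sign σ : ℤ) : K) * θ v := θ.isIntertwining _ _ σ v
  have h' := wedge_comp_perm K f σ
  change θ v • wedge K (f ∘ σ) = θ (ρ σ v) • wedge K f
  rw [h', smul_smul, h, mul_comm]

/-- The linear map from the induction of the sign representation to the exterior power of the
reflection representation. -/
def signLift (N : ℕ) (θ : ρ.Equiv (signRep K (m + 1))) :
    (((Fin (m + 1) ↪ Fin (N + 1)) →₀ V) ⧸ balanced (N + 1) ρ) →ₗ[K]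
      ⋀[K]^m (SumZero K (N + 1)) :=
  inducedLift (fun f : Fin (m + 1) ↪ Fin (N + 1) =>
      LinearMap.toSpanSingleton K _ (wedge K f) ∘ₗ θ.toLinearMap) (signRep_balanced θ)

theorem signLift_tmk (θ : ρ.Equiv (signRep K (m + 1))) (f : Fin (m + 1) ↪ Fin (N + 1))
    (v : V) : signLift N θ (tmk ρ f v) = θ v • wedge K f :=
  inducedLift_tmk _ (signRep_balanced θ) f v

/-- The intertwining map from the induction of the sign representation to the exterior power of the
reflection representation. -/
def signToExterior (θ : ρ.Equiv (signRep K (m + 1))) :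
    (inducedRep (N + 1) ρ).IntertwiningMap (exteriorReflectionRep K (N + 1) m) where
  toLinearMap := signLift N θ
  isIntertwining' a := by
    refine inducedRep_hom_ext fun f v => ?_
    rw [LinearMap.comp_apply, LinearMap.comp_apply, signLift_tmk, map_smul,
      exteriorReflectionRep_wedge]
    by_cases ha : Function.Injective (a ∘ f)
    · rw [inducedRep_tmk ha, signLift_tmk]
      rfl
    · rw [inducedRep_tmk_of_not ha, map_zero, wedge_eq_zero K ha, smul_zero]

theorem signToExterior_tmk (θ : ρ.Equiv (signRep K (m + 1))) (f : Fin (m + 1) ↪ Fin (N + 1))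
    (v : V) : signToExterior θ (tmk ρ f v) = θ v • wedge K f :=
  signLift_tmk θ f v

theorem simpleRep_equiv_exterior (hm : m ≤ N) {i : Fin (m + 1) ↪ Fin (N + 1)}
    {r : Fin (N + 1) → Fin (m + 1)} (hi : Monotone i) (hr : Monotone r) (hri : ∀ k, r (i k) = k)
    (hρ : ρ.IsIrreducible) (θ : ρ.Equiv (signRep K (m + 1))) :
    Nonempty ((simpleRep (N + 1) ρ).Equiv (exteriorReflectionRep K (N + 1) m)) := by
  have hirr := exteriorReflectionRep_irreducible K hm hi hr hri
  refine head_equiv_of_surjective (nullSub_ne_top hri hρ) (eq_top_of_not_le_nullSub hri hρ) hirr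
    (signToExterior θ) (surjective_of_ne_zero hirr _ (x := tmk ρ i (θ.symm 1)) ?_)
  rw [signToExterior_tmk, θ.apply_symm_apply, one_smul]
  exact wedge_ne_zero K hm hri

end Sign

/-! ### Recovering a simple module from the image of an idempotent -/

section Converse

variable {K L : Type*} [Field K] [AddCommGroup L] [Module K L] {n l : ℕ}
  {i : Fin l ↪ Fin n} {r : Fin n → Fin l}

/-- The composition of two maps through `Fin l`, as an element of the transformation monoid. -/
def thru (f : Fin l → Fin n) (g : Fin n → Fin l) : TMon n := f ∘ g

theorem mul_thru (a : TMon n) (f : Fin l → Fin n) (g : Fin n → Fin l) :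
    a * thru f g = thru (a ∘ f) g := rfl

theorem thru_mul_thru (hri : ∀ k, r (i k) = k) (f : Fin l → Fin n) (g : Fin l → Fin l) :
    thru f r * thru (i ∘ g) r = thru (f ∘ g) r := by
  funext y
  exact congrArg f (hri _)

theorem thru_mul_self (hri : ∀ k, r (i k) = k) (f : Fin l → Fin n) :
    thru f r * thru i r = thru f r := by
  funext y
  exact congrArg f (hri _)

theorem apply_mem_range (π : Representation K (TMon n) L) (hri : ∀ k, r (i k) = k)
    (σ : Fin l → Fin l) (x : L) : π (thru (i ∘ σ) r) x ∈ LinearMap.range (π (thru i r)) := by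
  rw [← thru_mul_thru hri, map_mul]
  exact ⟨_, rfl⟩

theorem apply_of_mem_range {π : Representation K (TMon n) L} (hri : ∀ k, r (i k) = k) {x : L}
    (hx : x ∈ LinearMap.range (π (thru i r))) : π (thru i r) x = x := by
  obtain ⟨y, rfl⟩ := hx
  rw [← Module.End.mul_apply, ← map_mul, thru_mul_self hri]

/-- The representation of the symmetric group on the image of an idempotent. -/
def cornerRep (π : Representation K (TMon n) L) (hri : ∀ k, r (i k) = k) :
    Representation K (Equiv.Perm (Fin l)) (LinearMap.range (π (thru i r))) where
  toFun σ := (π (thru (i ∘ σ) r)).restrict fun x _ => apply_mem_range π hri σ x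
  map_one' := LinearMap.ext fun x => Subtype.ext (apply_of_mem_range hri x.2)
  map_mul' σ τ := LinearMap.ext fun x => Subtype.ext (by
    change π (thru ((i ∘ σ) ∘ τ) r) x.1 = π (thru (i ∘ σ) r) (π (thru (i ∘ τ) r) x.1)
    rw [← thru_mul_thru hri (i ∘ σ), map_mul, Module.End.mul_apply])

theorem apply_thru_eq_zero (hl : 1 ≤ l) (hri : ∀ k, r (i k) = k) {π : Representation K (TMon n) L}
    (ha : IsApex π (tCell n l)) {f : Fin l → Fin n} (hf : ¬ Function.Injective f) :
    π (thru f r) = 0 :=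
  apply_eq_zero_of_isApex (isStrandCell_id hl hri) ha (throughStrands_comp_lt hf r)
    ⟨thru f r, 1, by rw [mul_one]; exact (thru_mul_self hri f).symm⟩

/-- With `e = i ∘ r`, `e a e = i ∘ (r a i) ∘ r` acts on the image of `e` as a permutation if `r a i`
is injective and as zero otherwise. So `e` maps the full orbit span of `v` into its span under the
symmetric group. -/
theorem cornerRep_irreducible (hl : 1 ≤ l) (hri : ∀ k, r (i k) = k)
    {π : Representation K (TMon n) L} (hπ : π.IsIrreducible) (ha : IsApex π (tCell n l)) :
    (cornerRep π hri).IsIrreducible := by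
  have he := apply_ne_zero_of_isApex (isStrandCell_id hl hri) ha
  have : Nontrivial (LinearMap.range (π (thru i r))) :=
    Submodule.nontrivial_iff_ne_bot.2 fun h => he (LinearMap.range_eq_bot.1 h)
  refine irreducible_of_span_orbit fun v hv => top_unique fun w _ => ?_
  have h1 : ∀ x ∈ Submodule.span K (Set.range fun a => π a v.1), π (thru i r) x ∈
      (Submodule.span K (Set.range fun σ => cornerRep π hri σ v)).map (Submodule.subtype _) := by
    intro x hx
    induction hx using Submodule.span_induction with
    | mem x hx =>
      obtain ⟨a, rfl⟩ := hx
      have h2 : π (thru i r) (π a v.1) = π (thru (i ∘ (r ∘ a ∘ i)) r) v.1 := by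
        conv_lhs => rw [← apply_of_mem_range hri v.2]
        rw [← Module.End.mul_apply, ← Module.End.mul_apply, ← map_mul, ← map_mul]
        rfl
      change π (thru i r) (π a v.1) ∈ _
      rw [h2]
      by_cases h : Function.Injective (r ∘ a ∘ i)
      · let σ : Equiv.Perm (Fin l) := Equiv.ofBijective _ (Finite.injective_iff_bijective.1 h)
        exact ⟨cornerRep π hri σ v, Submodule.subset_span ⟨σ, rfl⟩, rfl⟩
      · have h3 := apply_thru_eq_zero hl hri ha (f := i ∘ (r ∘ a ∘ i))
          fun h' => h (Function.Injective.of_comp (f := i) h')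
        rw [h3]
        exact zero_mem _
    | zero => rw [map_zero]; exact zero_mem _
    | add x y _ _ hx hy => rw [map_add]; exact add_mem hx hy
    | smul c x _ hx => rw [map_smul]; exact Submodule.smul_mem _ _ hx
  have hv' : v.1 ≠ 0 := fun h => hv (Subtype.ext h)
  have h2 := h1 w.1 (by rw [span_orbit_eq_top hπ hv']; trivial)
  rw [apply_of_mem_range hri w.2] at h2
  obtain ⟨w', hw', h3⟩ := h2
  rwa [← Subtype.ext (a1 := w') (a2 := w) h3]

theorem cornerRep_balanced (π : Representation K (TMon n) L) (hri : ∀ k, r (i k) = k)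
    (f : Fin l ↪ Fin n) (σ : Equiv.Perm (Fin l)) (v : LinearMap.range (π (thru i r))) :
    (π (thru (σ.toEmbedding.trans f) r) ∘ₗ Submodule.subtype _) v =
      (π (thru f r) ∘ₗ Submodule.subtype _) (cornerRep π hri σ v) := by
  change π (thru (f ∘ σ) r) v.1 = π (thru f r) (π (thru (i ∘ σ) r) v.1)
  rw [← Module.End.mul_apply, ← map_mul, thru_mul_thru hri]

/-- The map from the induction of the image of an idempotent. -/
def cornerMap (hl : 1 ≤ l) (hri : ∀ k, r (i k) = k) {π : Representation K (TMon n) L}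
    (ha : IsApex π (tCell n l)) : (inducedRep n (cornerRep π hri)).IntertwiningMap π where
  toLinearMap := inducedLift (fun f : Fin l ↪ Fin n => π (thru f r) ∘ₗ Submodule.subtype _)
    (cornerRep_balanced π hri)
  isIntertwining' a := by
    refine inducedRep_hom_ext fun f v => ?_
    rw [LinearMap.comp_apply, LinearMap.comp_apply, inducedLift_tmk]
    change _ = π a (π (thru f r) v.1)
    rw [← Module.End.mul_apply, ← map_mul, mul_thru]
    by_cases hf : Function.Injective (a ∘ f)
    · rw [inducedRep_tmk hf, inducedLift_tmk]
      rfl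
    · rw [inducedRep_tmk_of_not hf, map_zero, apply_thru_eq_zero hl hri ha hf]
      rfl

theorem cornerMap_tmk (hl : 1 ≤ l) (hri : ∀ k, r (i k) = k) {π : Representation K (TMon n) L}
    (ha : IsApex π (tCell n l)) (f : Fin l ↪ Fin n) (v : LinearMap.range (π (thru i r))) :
    cornerMap hl hri ha (tmk (cornerRep π hri) f v) = π (thru f r) v.1 :=
  inducedLift_tmk _ (cornerRep_balanced π hri) f v

/-- The map `f ⊗ v ↦ (f ∘ r) v` fixes the vectors of the corner, in the sense `i ⊗ v ↦ v`; being
nonzero, it is onto and identifies the head with `π`. -/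
theorem simpleRep_cornerRep_equiv (hl : 1 ≤ l) (hri : ∀ k, r (i k) = k)
    {π : Representation K (TMon n) L} (hπ : π.IsIrreducible) (ha : IsApex π (tCell n l)) :
    Nonempty (π.Equiv (simpleRep n (cornerRep π hri))) := by
  have hirr := cornerRep_irreducible hl hri hπ ha
  have := nontrivial_of_irreducible hirr
  obtain ⟨v, hv⟩ := exists_ne (0 : LinearMap.range (π (thru i r)))
  have h : cornerMap hl hri ha (tmk (cornerRep π hri) i v) ≠ 0 := by
    rw [cornerMap_tmk, apply_of_mem_range hri v.2]
    exact fun h => hv (Subtype.ext h)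
  obtain ⟨E⟩ := head_equiv_of_surjective (nullSub_ne_top hri hirr)
    (eq_top_of_not_le_nullSub hri hirr) hπ (cornerMap hl hri ha) (surjective_of_ne_zero hπ _ h)
  exact ⟨E.symm⟩

end Converse

/-! ### Uniqueness of the planar simple module -/

section Planar

variable {K L : Type*} [Field K] [AddCommGroup L] [Module K L] {n l : ℕ}
  {i : Fin l → Fin n} {r : Fin n → Fin l}

/-- Here `e a e = i ∘ u ∘ r` with `u = r a i` monotone: either `u` is the identity, or it is not
injective and the product has fewer than `l` strands. -/
theorem planar_character (hl : 1 ≤ l) (hi : Monotone i) (hr : Monotone r)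
    (hri : ∀ k, r (i k) = k) {π : Representation K (PTMon n) L} (ha : IsApex π (ptCell n l))
    (a : PTMon n) :
    π (planar (hi.comp hr) * a * planar (hi.comp hr)) =
      (open Classical in if (∀ k, r (a.1 (i k)) = k) then (1 : K) else 0) •
        π (planar (hi.comp hr)) := by
  split_ifs with h
  · rw [one_smul]
    congr 1
    refine Subtype.ext (funext fun x => ?_)
    change i (r (a.1 (i (r x)))) = i (r x)
    rw [h]
  · rw [zero_smul]
    have hu : Monotone fun k => r (a.1 (i k)) := fun j k hjk => hr (a.2 _ _ (hi hjk))
    have hinj : ¬ Function.Injective fun k => r (a.1 (i k)) := fun h' =>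
      h (congrFun (eq_id_of_monotone_injective hu h'))
    refine apply_eq_zero_of_isApex (isStrandCell_planar hl hi hr hri) ha ?_
      ⟨1, a * planar (hi.comp hr), by rw [one_mul, mul_assoc]⟩
    exact throughStrands_comp_lt (f := fun k => i (r (a.1 (i k)))) (fun h' => hinj
      (Function.Injective.of_comp (f := i) h')) r

theorem planar_equiv {L' : Type*} [AddCommGroup L'] [Module K L'] (hl : 1 ≤ l) (hi : Monotone i)
    (hr : Monotone r) (hri : ∀ k, r (i k) = k) {π : Representation K (PTMon n) L}
    {π' : Representation K (PTMon n) L'} (hπ : π.IsIrreducible) (hπ' : π'.IsIrreducible)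
    (ha : IsApex π (ptCell n l)) (ha' : IsApex π' (ptCell n l)) : Nonempty (π.Equiv π') := by
  refine equiv_of_character hπ hπ' (e := planar (hi.comp hr)) ?_
    (planar_character hl hi hr hri ha) (planar_character hl hi hr hri ha')
    (apply_ne_zero_of_isApex (isStrandCell_planar hl hi hr hri) ha)
    (apply_ne_zero_of_isApex (isStrandCell_planar hl hi hr hri) ha')
  refine Subtype.ext (funext fun x => ?_)
  change i (r (i (r x))) = i (r x)
  rw [hri]

theorem planarExterior_isApex (K : Type*) [Field K] {N m : ℕ} (hm : m ≤ N)
    {i : Fin (m + 1) → Fin (N + 1)} {r : Fin (N + 1) → Fin (m + 1)} (hi : Monotone i)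
    (hr : Monotone r) (hri : ∀ k, r (i k) = k) :
    IsApex (planarExterior K N m) (ptCell (N + 1) (m + 1)) := by
  refine isApex_of (isStrandCell_planar (Nat.le_add_left 1 m) hi hr hri) (fun h => ?_)
    fun b hb => exteriorReflectionRep_eq_zero K hb
  refine wedge_ne_zero K hm hri ?_
  have h1 : planarExterior K N m (planar (hi.comp hr)) (wedge K i) = wedge K i := by
    refine (exteriorReflectionRep_wedge K _ i).trans (congrArg (wedge K) (funext fun k => ?_))
    exact congrArg i (hri k)
  rw [← h1, h]
  rfl

end Planar

end TransMonoid

end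

theorem mainTheorem9 (K : Type u) [Field K] [CharZero K] (n l : ℕ) (hl : 1 ≤ l) (hln : l ≤ n) :
    -- the simple `T_n`-modules attached to the simple `S_l`-modules
    (∀ (V : Type v) [AddCommGroup V] [Module K V]
        (ρ : Representation K (Equiv.Perm (Fin l)) V), ρ.IsIrreducible →
      (TransMonoid.simpleRep n ρ).IsIrreducible ∧
      TransMonoid.IsApex (TransMonoid.simpleRep n ρ) (TransMonoid.tCell n l) ∧
      Module.Finite K V ∧ Module.Finite K (TransMonoid.SimpleSpace n ρ) ∧
      (IsEmpty (ρ.Equiv (TransMonoid.signRep K l)) →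
        Module.finrank K (TransMonoid.SimpleSpace n ρ) = n.choose l * Module.finrank K V) ∧
      (Nonempty (ρ.Equiv (TransMonoid.signRep K l)) →
        Module.finrank K (TransMonoid.SimpleSpace n ρ) = (n - 1).choose (l - 1) ∧
        Nonempty ((TransMonoid.simpleRep n ρ).Equiv
          (TransMonoid.exteriorReflectionRep K n (l - 1))))) ∧
    -- every simple `T_n`-module with apex `l` is one of them
    (∀ (L : Type v) [AddCommGroup L] [Module K L]
        (π : Representation K (TransMonoid.TMon n) L), π.IsIrreducible →
      TransMonoid.IsApex π (TransMonoid.tCell n l) →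
      ∃ (V : Type v) (_ : AddCommGroup V) (_ : Module K V)
        (ρ : Representation K (Equiv.Perm (Fin l)) V),
        ρ.IsIrreducible ∧ Nonempty (π.Equiv (TransMonoid.simpleRep n ρ))) ∧
    -- the unique simple module with apex `l` of the planar transformation monoid
    (∃ (P : Type u) (_ : AddCommGroup P) (_ : Module K P)
        (π₀ : Representation K (TransMonoid.PTMon n) P),
      π₀.IsIrreducible ∧ TransMonoid.IsApex π₀ (TransMonoid.ptCell n l) ∧
      Module.finrank K P = (n - 1).choose (l - 1) ∧
      ∀ (L : Type v) [AddCommGroup L] [Module K L]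
        (π : Representation K (TransMonoid.PTMon n) L), π.IsIrreducible →
        TransMonoid.IsApex π (TransMonoid.ptCell n l) →
        Nonempty (π.Equiv π₀) ∧ Module.finrank K L = (n - 1).choose (l - 1)) := by
  obtain ⟨i, r, hi, hr, hri⟩ := TransMonoid.exists_retraction hl hln
  -- Passing to `m = l - 1` and `N = n - 1` makes the degree of the exterior power and the binomial
  -- coefficient free of truncated subtraction.
  obtain ⟨m, rfl⟩ : ∃ m, l = m + 1 := ⟨l - 1, by omega⟩
  obtain ⟨N, rfl⟩ : ∃ N, n = N + 1 := ⟨n - 1, by omega⟩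
  have hm : m ≤ N := by omega
  have hri' : ∀ k, r ((⟨i, hi.injective⟩ : Fin (m + 1) ↪ Fin (N + 1)) k) = k := hri
  refine ⟨fun V _ _ ρ hρ => ⟨TransMonoid.simpleRep_irreducible hri' hρ,
    TransMonoid.simpleRep_isApex hl hri' hρ, TransMonoid.finite_of_irreducible hρ,
    TransMonoid.finite_simpleSpace hρ, TransMonoid.finrank_simpleSpace hri' hρ, fun ⟨θ⟩ => ?_⟩,
    fun L _ _ π hπ ha => ?_, ?_⟩
  · obtain ⟨E⟩ := TransMonoid.simpleRep_equiv_exterior hm hi.monotone hr hri' hρ θ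
    exact ⟨E.toLinearEquiv.finrank_eq.trans (TransMonoid.finrank_exterior K N m), ⟨E⟩⟩
  · exact ⟨_, _, _, TransMonoid.cornerRep π hri', TransMonoid.cornerRep_irreducible hl hri' hπ ha,
      TransMonoid.simpleRep_cornerRep_equiv hl hri' hπ ha⟩
  · have hirr := TransMonoid.planarExterior_irreducible K hm hi.monotone hr hri
    have hap := TransMonoid.planarExterior_isApex K hm hi.monotone hr hri
    refine ⟨_, _, _, TransMonoid.planarExterior K N m, hirr, hap,
      TransMonoid.finrank_exterior K N m, fun L _ _ π hπ ha => ?_⟩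
    obtain ⟨E⟩ := TransMonoid.planar_equiv hl hi.monotone hr hri hπ hirr ha hap
    exact ⟨⟨E⟩, E.toLinearEquiv.finrank_eq.trans (TransMonoid.finrank_exterior K N m)⟩
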